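/- **Theorem 1.** A *claw* is the star $K_{1,3}$ and a *diamond* is $K_4$ with one edge removed. An instance of the parameterized problem $\{$Claw, Diamond$\}$-Free Edge Deletion is a pair $(G,k)$ of a finite simple graph $G$ and a positive integer $k$, the parameter; it is a yes-instance if there is a set of at most $k$ edges of $G$ whose deletion results in a graph that has neither a claw nor a diamond as an induced subgraph. The problem $\{$Claw, Diamond$\}$-Free Edge Deletion has a kernel with $O(k^3)$ vertices and $O(k^4)$ edges. That is, there are a constant $C$, computable functions $f,g:\mathbb{N}\to\mathbb{N}$, and an algorithm that transforms every instance $(G,k)$ into an instance $(G',k')$ such that 1. the algorithm runs in time $(|G|+k)^{O(1)}$, where $|G|$ is the length of the description of $G$ by its adjacency matrix; 2. $(G,k)$ is a yes-instance if and only if $(G',k')$ is a yes-instance; 3. $k'\le f(k)$ and $|G'|\le g(k)$; 4. $G'$ has at most $C k^3$ vertices and at most $C k^4$ edges. -/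

import Mathlib

/-! ### Graphs without induced claws and diamonds -/

/-- The claw: the star with three leaves. -/
abbrev clawGraph : SimpleGraph (Fin 1 ⊕ Fin 3) :=
  completeBipartiteGraph (Fin 1) (Fin 3)

/-- The diamond: the complete graph on four vertices with one edge missing. -/
abbrev diamondGraph : SimpleGraph (Fin 4) :=
  (⊤ : SimpleGraph (Fin 4)).deleteEdges {s(0, 1)}

/-- No induced subgraph of `G` is a claw or a diamond. -/
def IsClawDiamondFree {V : Type*} (G : SimpleGraph V) : Prop :=
  ¬ clawGraph.IsIndContained G ∧ ¬ diamondGraph.IsIndContained G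

/-- `S` is a claw and diamond hitting set of `G`: a set of edges of `G` whose deletion leaves a
graph without induced claws and diamonds. -/
def IsCDHSet {V : Type*} (G : SimpleGraph V) (S : Finset (Sym2 V)) : Prop :=
  (S : Set (Sym2 V)) ⊆ G.edgeSet ∧ IsClawDiamondFree (G.deleteEdges (S : Set (Sym2 V)))

/-! ### Instances -/

/-- An instance of a parameterized graph problem: a finite simple graph, with vertices numbered
`0, …, n - 1`, and a positive integer, the parameter. -/
structure GraphInstance where
  /-- the number of vertices -/
  n : ℕ
  /-- the graph -/
  graph : SimpleGraph (Fin n)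
  /-- the parameter -/
  k : ℕ
  /-- the parameter is positive -/
  k_pos : 0 < k

namespace GraphInstance

/-- The length of the description of the graph by its adjacency matrix. -/
def size (I : GraphInstance) : ℕ := I.n * I.n

/-- The number of edges. -/
noncomputable def numEdges (I : GraphInstance) : ℕ := I.graph.edgeSet.ncard

end GraphInstance

/-- The yes-instances of {Claw, Diamond}-Free Edge Deletion. -/
def ClawDiamondFreeEdgeDeletion : Set GraphInstance :=
  {I | ∃ S : Finset (Sym2 (Fin I.n)), IsCDHSet I.graph S ∧ S.card ≤ I.k}

/-! ### Algorithms: a random access machine with a step count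

Programs are while-programs over natural numbers. They work on variables and on arrays (with two
indices), all of unbounded size; a program is a finite text and so mentions only finitely many
variables and arrays. The arithmetic is addition and truncated subtraction only, so that in `t`
steps numbers of `O(t)` bits more than those of the input can be built, and counting each operation
as one step is polynomially equivalent to Turing machine time. -/

namespace RAM

/-- A memory: the values of the variables and of the cells of the arrays. -/
structure State where
  /-- the value of a variable -/
  var : ℕ → ℕ
  /-- the value of an array at a row and a column -/
  arr : ℕ → ℕ → ℕ → ℕ

namespace State

/-- Assign a value to a variable. -/
def setVar (s : State) (x v : ℕ) : State :=
  { s with var := fun y => if y = x then v else s.var y }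

/-- Assign a value to a cell of an array. -/
def setArr (s : State) (a i j v : ℕ) : State :=
  { s with arr := fun b p q => if b = a ∧ p = i ∧ q = j then v else s.arr b p q }

end State

/-- Arithmetical expressions. -/
inductive Expr
  /-- a constant -/
  | const (c : ℕ)
  /-- a variable -/
  | var (x : ℕ)
  /-- the cell of the array `a` at the row `i` and the column `j` -/
  | get (a : ℕ) (i j : Expr)
  /-- addition -/
  | add (e₁ e₂ : Expr)
  /-- truncated subtraction -/
  | sub (e₁ e₂ : Expr)

/-- The value of an expression. -/
def Expr.eval (s : State) : Expr → ℕ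
  | .const c => c
  | .var x => s.var x
  | .get a i j => s.arr a (i.eval s) (j.eval s)
  | .add e₁ e₂ => e₁.eval s + e₂.eval s
  | .sub e₁ e₂ => e₁.eval s - e₂.eval s

/-- The number of nodes of an expression: the number of operations needed to evaluate it. -/
def Expr.cost : Expr → ℕ
  | .const _ => 1
  | .var _ => 1
  | .get _ i j => i.cost + j.cost + 1
  | .add e₁ e₂ => e₁.cost + e₂.cost + 1
  | .sub e₁ e₂ => e₁.cost + e₂.cost + 1

/-- Programs. Tests succeed when the value of the expression is not zero. -/
inductive Program
  /-- do nothing -/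
  | skip
  /-- `x := e` -/
  | assign (x : ℕ) (e : Expr)
  /-- `a[i, j] := e` -/
  | store (a : ℕ) (i j e : Expr)
  /-- first `p`, then `q` -/
  | seq (p q : Program)
  /-- if `e ≠ 0` then `p` else `q` -/
  | cond (e : Expr) (p q : Program)
  /-- while `e ≠ 0` do `p` -/
  | loop (e : Expr) (p : Program)

/-- `Exec p s s' t`: started in the memory `s`, the program `p` halts after exactly `t` steps in
the memory `s'`. -/
inductive Exec : Program → State → State → ℕ → Prop
  | skip (s : State) : Exec .skip s s 1
  | assign (s : State) (x : ℕ) (e : Expr) :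
      Exec (.assign x e) s (s.setVar x (e.eval s)) (e.cost + 1)
  | store (s : State) (a : ℕ) (i j e : Expr) :
      Exec (.store a i j e) s (s.setArr a (i.eval s) (j.eval s) (e.eval s))
        (i.cost + j.cost + e.cost + 1)
  | seq {p q : Program} {s s' s'' : State} {t t' : ℕ} :
      Exec p s s' t → Exec q s' s'' t' → Exec (.seq p q) s s'' (t + t')
  | cond_true {e : Expr} {p q : Program} {s s' : State} {t : ℕ} :
      e.eval s ≠ 0 → Exec p s s' t → Exec (.cond e p q) s s' (e.cost + 1 + t)
  | cond_false {e : Expr} {p q : Program} {s s' : State} {t : ℕ} :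
      e.eval s = 0 → Exec q s s' t → Exec (.cond e p q) s s' (e.cost + 1 + t)
  | loop_true {e : Expr} {p : Program} {s s' s'' : State} {t t' : ℕ} :
      e.eval s ≠ 0 → Exec p s s' t → Exec (.loop e p) s' s'' t' →
        Exec (.loop e p) s s'' (e.cost + 1 + t + t')
  | loop_false {e : Expr} {p : Program} {s : State} :
      e.eval s = 0 → Exec (.loop e p) s s (e.cost + 1)

open Classical in
/-- The memory that holds an instance as input: the number of vertices in variable `0`, the
parameter in variable `1`, the adjacency matrix in array `0`, and zeros everywhere else. -/
noncomputable def State.input (I : GraphInstance) : State where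
  var x := if x = 0 then I.n else if x = 1 then I.k else 0
  arr a i j :=
    if a = 0 ∧ ∃ (hi : i < I.n) (hj : j < I.n), I.graph.Adj ⟨i, hi⟩ ⟨j, hj⟩ then 1 else 0

open Classical in
/-- A memory holds an instance as output: the number of vertices is in variable `0`, the parameter
in variable `1`, and the adjacency matrix in array `0`. All other cells are ignored. -/
def State.IsOutput (s : State) (I : GraphInstance) : Prop :=
  s.var 0 = I.n ∧ s.var 1 = I.k ∧
    ∀ i j : Fin I.n, s.arr 0 i j = if I.graph.Adj i j then 1 else 0

/-- The function `κ` is computed by an algorithm that runs in time polynomial in the sum of the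
size and the parameter of the instance. -/
def IsPolyTime (κ : GraphInstance → GraphInstance) : Prop :=
  ∃ (P : Program) (b : Polynomial ℕ), ∀ I : GraphInstance, ∃ (s : State) (t : ℕ),
    Exec P (State.input I) s t ∧ s.IsOutput (κ I) ∧ t ≤ b.eval (I.size + I.k)

end RAM

/-! ### Kernelizations -/

/-- `κ` is a kernelization for the parameterized problem `Q`: a polynomial-time transformation of
instances into equivalent instances, such that the new parameter and the size of the new instance
are bounded by computable functions of the old parameter. -/
structure IsKernelization (Q : Set GraphInstance) (κ : GraphInstance → GraphInstance) : Prop where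
  polyTime : RAM.IsPolyTime κ
  mem_iff : ∀ I, I ∈ Q ↔ κ I ∈ Q
  parameter_le : ∃ f : ℕ → ℕ, Computable f ∧ ∀ I, (κ I).k ≤ f I.k
  size_le : ∃ g : ℕ → ℕ, Computable g ∧ ∀ I, (κ I).size ≤ g I.k

/-!
The kernelization keeps a set `X` of vertices, a set `A` of vertices near `X`, and a bounded part of
the cliques that are attached to `A`.

Obstructions (induced claws and diamonds) are collected greedily, each one without an edge inside
the set `X` of the vertices collected before it. They are edge-disjoint, so more than `k` of them
show that the instance is negative (`Packing.not_deletable`), and the subgraph induced by `X` is an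
equivalent instance. Otherwise `X` has at most `4 * k` vertices and every obstruction has an edge
inside `X` (`IsModulator`). This forces a rigid structure on the rest of the graph: every edge
outside `X` lies in exactly one maximal clique, no claw has its centre outside `X`, and the
neighbours outside `X` of a vertex of `X` form at most two cliques. A maximal clique is attached if
it meets `X`, and detached otherwise; a neighbour of `X` lies in at most one detached clique.

Let `T = 2 * k + 6`. The set `A` (`keptSet`) holds the `T` smallest vertices of each attached clique
and the vertices in which attached cliques meet, `O(k ^ 2)` vertices in all. The reduced graph has
the edges inside `X ∪ A`, and in the detached clique of each `a ∈ A` the edges between its `T`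
smallest vertices and its members in `A`. It has `O(k ^ 2 * T)` vertices that are not isolated, and
`O((k ^ 2) ^ 2 + k ^ 2 * T ^ 2)` edges.

The neighbourhoods of the reduced graph are induced subgraphs of those of `G`
(`reduced_locally_induced`), so a solution of `G` restricts to one of the reduced graph. Conversely,
let `S` be a solution of the reduced graph. Call `a ∈ A` bad if its attached neighbours do not form
a clique after the deletion of `S`. To avoid a claw, `S` then contains all edges from `a` into its
detached clique, and this clique was not truncated (`IsKeptSet.mem_of_bad`). Hence the edges of `S`
inside detached cliques may be restored unless they have a bad end. The edges that remain
(`neededEdges`) form a solution of `G`: in an obstruction around a centre in `X ∪ A`, vertices of a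
truncated attached clique can be exchanged for kept ones that `S` does not touch
(`IsKeptSet.exists_exchange`), and around the other centres the neighbourhood is a union of two
cliques with no edges between them.

The program consists of a fourfold loop for the greedy packing and of ten tables. An entry of a
table is computed from the number of vertices `w` with some property that is decided by the earlier
tables, so that one rule (`tabulate_holds`) covers the existential quantifiers as well as the
positions of vertices in cliques.
-/

/-! ### Obstructions and deletion sets -/

section Obstructions

variable {V : Type*}

/-- `c` together with its neighbours `u`, `v`, `w` induces a claw with centre `c`, or a diamond in
which `u` and `w` are the two non-adjacent vertices. -/
def Obstruction (G : SimpleGraph V) (c u v w : V) : Prop :=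
  G.Adj c u ∧ G.Adj c v ∧ G.Adj c w ∧ u ≠ w ∧ ¬ G.Adj u w ∧
    ((G.Adj u v ∧ G.Adj v w) ∨ (u ≠ v ∧ v ≠ w ∧ ¬ G.Adj u v ∧ ¬ G.Adj v w))

theorem Obstruction.ne₁₂ {G : SimpleGraph V} {c u v w : V} (h : Obstruction G c u v w) : u ≠ v := by
  rcases h with ⟨-, -, -, -, -, ⟨h, -⟩ | ⟨h, -⟩⟩
  · exact h.ne
  · exact h

theorem Obstruction.ne₂₃ {G : SimpleGraph V} {c u v w : V} (h : Obstruction G c u v w) : v ≠ w := by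
  rcases h with ⟨-, -, -, -, -, ⟨-, h⟩ | ⟨-, h, -⟩⟩
  · exact h.ne
  · exact h

theorem Obstruction.symm {G : SimpleGraph V} {c u v w : V} (h : Obstruction G c u v w) :
    Obstruction G c w v u := by
  obtain ⟨h1, h2, h3, h4, h5, h6⟩ := h
  refine ⟨h3, h2, h1, h4.symm, fun h => h5 h.symm, ?_⟩
  exact h6.imp (fun h => ⟨h.2.symm, h.1.symm⟩)
    fun h => ⟨h.2.1.symm, h.1.symm, fun h' => h.2.2.2 h'.symm, fun h' => h.2.2.1 h'.symm⟩

theorem Obstruction.exchange_first {G : SimpleGraph V} {c u v w y : V} (h : Obstruction G c u v w)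
    (hy : G.Adj c y) (hyv : y ≠ v) (hyw : y ≠ w) (ev : G.Adj y v ↔ G.Adj u v)
    (ew : G.Adj y w ↔ G.Adj u w) : Obstruction G c y v w := by
  obtain ⟨-, h2, h3, -, h5, h6⟩ := h
  refine ⟨hy, h2, h3, hyw, by rwa [ew], ?_⟩
  rw [ev]
  exact h6.imp_right fun h => ⟨hyv, h.2⟩

theorem Obstruction.exchange_second {G : SimpleGraph V} {c u v w y : V} (h : Obstruction G c u v w)
    (hy : G.Adj c y) (hyu : y ≠ u) (hyw : y ≠ w) (eu : G.Adj y u ↔ G.Adj v u)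
    (ew : G.Adj y w ↔ G.Adj v w) : Obstruction G c u y w := by
  obtain ⟨h1, -, h3, h4, h5, h6⟩ := h
  refine ⟨h1, hy, h3, h4, h5, ?_⟩
  rw [G.adj_comm u y, eu, ew, G.adj_comm v u]
  exact h6.imp_right fun h => ⟨hyu.symm, hyw, h.2.2⟩

theorem isClawDiamondFree_iff (G : SimpleGraph V) :
    IsClawDiamondFree G ↔ ∀ c u v w, ¬ Obstruction G c u v w := by
  constructor
  · rintro ⟨hc, hd⟩ c u v w h
    have h12 := h.ne₁₂
    have h23 := h.ne₂₃
    obtain ⟨hcu, hcv, hcw, hne, huw, ⟨huv, hvw⟩ | ⟨-, -, huv, hvw⟩⟩ := h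
    · refine hd ⟨⟨⟨![u, w, c, v], ?_⟩, ?_⟩⟩
      · intro i j hij
        have := hcu.ne; have := hcv.ne; have := hcw.ne
        fin_cases i <;> fin_cases j <;> simp_all
      · intro i j
        change G.Adj (![u, w, c, v] i) (![u, w, c, v] j) ↔ _
        have := hcu.symm; have := hcv.symm; have := hcw.symm
        have := huv.symm; have := hvw.symm
        have : ¬ G.Adj w u := fun h => huw h.symm
        fin_cases i <;> fin_cases j <;> simp_all [diamondGraph]
    · refine hc ⟨⟨⟨Sum.elim (fun _ => c) ![u, v, w], ?_⟩, ?_⟩⟩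
      · have := hcu.ne; have := hcv.ne; have := hcw.ne
        rintro (i | i) (j | j) hij <;> fin_cases i <;> fin_cases j <;> simp_all
      · have := hcu.symm; have := hcv.symm; have := hcw.symm
        have : ¬ G.Adj w u := fun h => huw h.symm
        have : ¬ G.Adj v u := fun h => huv h.symm
        have : ¬ G.Adj w v := fun h => hvw h.symm
        intro i j
        change G.Adj (Sum.elim (fun _ => c) ![u, v, w] i) (Sum.elim (fun _ => c) ![u, v, w] j) ↔ _
        rcases i with i | i <;> rcases j with j | j <;> fin_cases i <;> fin_cases j <;>
          simp_all [clawGraph]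
  · intro h
    constructor
    · rintro ⟨f⟩
      have ha : ∀ a b, G.Adj (f a) (f b) ↔ clawGraph.Adj a b := fun a b => f.map_adj_iff
      have hi : ∀ a b, f a = f b ↔ a = b := fun a b => f.injective.eq_iff
      refine h (f (.inl 0)) (f (.inr 0)) (f (.inr 1)) (f (.inr 2)) ?_
      simp [Obstruction, ha, hi, clawGraph]
    · rintro ⟨f⟩
      have ha : ∀ a b, G.Adj (f a) (f b) ↔ diamondGraph.Adj a b := fun a b => f.map_adj_iff
      have hi : ∀ a b, f a = f b ↔ a = b := fun a b => f.injective.eq_iff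
      refine h (f 2) (f 0) (f 3) (f 1) ?_
      simp [Obstruction, ha, hi, diamondGraph]

/-- A vertex whose neighbourhood is the union of two cliques with no edges between them is not the
centre of an obstruction. The first clique consists of the neighbours that satisfy `P`. -/
theorem not_obstruction_of_two_cliques {H : SimpleGraph V} {c : V} (P : V → Prop)
    (h₁ : ∀ u w, H.Adj c u → H.Adj c w → u ≠ w → P u → P w → H.Adj u w)
    (h₂ : ∀ u w, H.Adj c u → H.Adj c w → u ≠ w → ¬ P u → ¬ P w → H.Adj u w)
    (h₃ : ∀ u w, H.Adj c u → H.Adj c w → P u → ¬ P w → ¬ H.Adj u w) (u v w : V) :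
    ¬ Obstruction H c u v w := by
  intro h
  have h12 := h.ne₁₂
  have h23 := h.ne₂₃
  obtain ⟨hu, hv, hw, huw, hn, h⟩ := h
  have hn' : ¬ H.Adj w u := fun h => hn h.symm
  have s1 := H.adj_comm u v
  have s2 := H.adj_comm v w
  by_cases pu : P u <;> by_cases pv : P v <;> by_cases pw : P w <;> grind

/-- `G` can be freed of obstructions by deleting at most `k` edges. -/
def Deletable (G : SimpleGraph V) (k : ℕ) : Prop :=
  ∃ S : Finset (Sym2 V), (S : Set (Sym2 V)) ⊆ G.edgeSet ∧ S.card ≤ k ∧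
    ∀ c u v w, ¬ Obstruction (G.deleteEdges (S : Set (Sym2 V))) c u v w

theorem deletable_of_finset {G : SimpleGraph V} {k : ℕ} (S : Finset (Sym2 V)) (hk : S.card ≤ k)
    (h : ∀ c u v w, ¬ Obstruction (G.deleteEdges (S : Set (Sym2 V))) c u v w) :
    Deletable G k := by
  classical
  refine ⟨S.filter (· ∈ G.edgeSet), ?_, (Finset.card_filter_le _ _).trans hk, ?_⟩
  · intro e he
    simp only [Finset.coe_filter, Set.mem_ofPred_eq] at he
    exact he.2
  · have : G.deleteEdges ((S.filter (· ∈ G.edgeSet) : Finset (Sym2 V)) : Set (Sym2 V)) =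
        G.deleteEdges (S : Set (Sym2 V)) := by
      ext a b
      simp only [SimpleGraph.deleteEdges_adj, Finset.coe_filter, Set.mem_ofPred_eq,
        SimpleGraph.mem_edgeSet, Finset.mem_coe]
      tauto
    rwa [this]

theorem mem_problem_iff (I : GraphInstance) :
    I ∈ ClawDiamondFreeEdgeDeletion ↔ Deletable I.graph I.k := by
  simp only [ClawDiamondFreeEdgeDeletion, IsCDHSet, Set.mem_ofPred_eq, isClawDiamondFree_iff,
    Deletable]
  constructor
  · rintro ⟨S, ⟨h1, h2⟩, h3⟩
    exact ⟨S, h1, h3, h2⟩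
  · rintro ⟨S, h1, h3, h2⟩
    exact ⟨S, ⟨h1, h2⟩, h3⟩

/-- Deletability passes to a graph `H` that is embedded in `G` so that every pair of vertices with
a common neighbour in `H` is adjacent in `H` as soon as it is adjacent in `G`: then the
neighbourhoods of `H` are induced subgraphs of those of `G`. -/
theorem Deletable.of_locally_induced {U : Type*} {G : SimpleGraph V} {H : SimpleGraph U} {k : ℕ}
    (f : U ↪ V) (hf : ∀ u v, H.Adj u v → G.Adj (f u) (f v))
    (hloc : ∀ v u w, H.Adj v u → H.Adj v w → G.Adj (f u) (f w) → H.Adj u w)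
    (hG : Deletable G k) : Deletable H k := by
  classical
  obtain ⟨S, -, hk, hS⟩ := hG
  have hinj : Function.Injective (Sym2.map f) := Sym2.map.injective f.injective
  refine deletable_of_finset (S.preimage (Sym2.map f) hinj.injOn) ?_ ?_
  · refine (Finset.card_le_card_of_injOn (Sym2.map f) ?_ hinj.injOn).trans hk
    intro e he
    simpa using he
  · intro c u v w h
    have key : ∀ a b, ((H.deleteEdges ((S.preimage (Sym2.map f) hinj.injOn : Finset _) :
        Set (Sym2 U))).Adj a b) ↔ H.Adj a b ∧ s(f a, f b) ∉ S := by
      intro a b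
      simp [SimpleGraph.deleteEdges_adj]
    apply hS (f c) (f u) (f v) (f w)
    simp only [Obstruction, key, SimpleGraph.deleteEdges_adj, Finset.mem_coe] at h ⊢
    have i1 : f u ≠ f w ↔ u ≠ w := f.injective.ne_iff
    have i2 : f u ≠ f v ↔ u ≠ v := f.injective.ne_iff
    have i3 : f v ≠ f w ↔ v ≠ w := f.injective.ne_iff
    rw [i1, i2, i3]
    obtain ⟨⟨c1, c1'⟩, ⟨c2, c2'⟩, ⟨c3, c3'⟩, h⟩ := h
    have e1 : G.Adj (f u) (f w) ↔ H.Adj u w := ⟨hloc c u w c1 c3, hf _ _⟩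
    have e2 : G.Adj (f u) (f v) ↔ H.Adj u v := ⟨hloc c u v c1 c2, hf _ _⟩
    have e3 : G.Adj (f v) (f w) ↔ H.Adj v w := ⟨hloc c v w c2 c3, hf _ _⟩
    rw [e1, e2, e3]
    exact ⟨⟨hf _ _ c1, c1'⟩, ⟨hf _ _ c2, c2'⟩, ⟨hf _ _ c3, c3'⟩, h⟩

/-- Isolated vertices do not matter for deletability. -/
theorem Deletable.of_embedding {U : Type*} {G : SimpleGraph V} {H : SimpleGraph U} {k : ℕ}
    (f : H ↪g G) (hf : ∀ u v, G.Adj u v → u ∈ Set.range f) (hH : Deletable H k) :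
    Deletable G k := by
  classical
  obtain ⟨S, -, hk, hS⟩ := hH
  refine deletable_of_finset (S.map ⟨Sym2.map f, Sym2.map.injective f.injective⟩) (by simpa) ?_
  have key : ∀ a b, (G.deleteEdges ((S.map ⟨Sym2.map f, Sym2.map.injective f.injective⟩ :
      Finset (Sym2 V)) : Set (Sym2 V))).Adj (f a) (f b) ↔
      (H.deleteEdges (S : Set (Sym2 U))).Adj a b := by
    intro a b
    simp only [SimpleGraph.deleteEdges_adj, f.map_adj_iff, Finset.mem_coe]
    have := Finset.mem_map' ⟨Sym2.map f, Sym2.map.injective f.injective⟩ (a := s(a, b)) (s := S)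
    exact and_congr_right' (not_congr this)
  intro c u v w h
  have hadj : ∀ {a b}, (G.deleteEdges ((S.map ⟨Sym2.map f, Sym2.map.injective f.injective⟩ :
      Finset (Sym2 V)) : Set (Sym2 V))).Adj a b → G.Adj a b :=
    fun h => (SimpleGraph.deleteEdges_adj.1 h).1
  obtain ⟨c, rfl⟩ := hf _ _ (hadj h.1)
  obtain ⟨u, rfl⟩ := hf _ _ (hadj h.1.symm)
  obtain ⟨v, rfl⟩ := hf _ _ (hadj h.2.1.symm)
  obtain ⟨w, rfl⟩ := hf _ _ (hadj h.2.2.1.symm)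
  apply hS c u v w
  simpa only [Obstruction, key, f.injective.ne_iff] using h

/-- Some edge of the obstruction formed by `c`, `u`, `v`, `w` has both ends in `X`. -/
def HasEdgeIn (G : SimpleGraph V) (X : Set V) (c u v w : V) : Prop :=
  (c ∈ X ∧ (u ∈ X ∨ v ∈ X ∨ w ∈ X)) ∨ (G.Adj u v ∧ u ∈ X ∧ v ∈ X) ∨ (G.Adj v w ∧ v ∈ X ∧ w ∈ X)

theorem HasEdgeIn.mono {G : SimpleGraph V} {X Y : Set V} (hXY : X ⊆ Y) {c u v w : V}
    (h : HasEdgeIn G X c u v w) : HasEdgeIn G Y c u v w := by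
  unfold HasEdgeIn at h ⊢
  have := @hXY c; have := @hXY u; have := @hXY v; have := @hXY w
  tauto

/-- `X` is the vertex set of `m` obstructions, listed so that none of them has an edge inside the
union of the earlier ones; in particular they are pairwise edge-disjoint. -/
inductive Packing (G : SimpleGraph V) : Set V → ℕ → Prop
  | empty : Packing G ∅ 0
  | extend {X : Set V} {m : ℕ} {c u v w : V} (h : Packing G X m) (ho : Obstruction G c u v w)
      (he : ¬ HasEdgeIn G X c u v w) : Packing G (X ∪ {c, u, v, w}) (m + 1)

theorem Packing.ncard_le {G : SimpleGraph V} {X : Set V} {m : ℕ} (h : Packing G X m) :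
    X.ncard ≤ 4 * m := by
  classical
  induction h with
  | empty => simp
  | @extend X m c u v w h ho he ih =>
    have h1 := Set.ncard_union_le X {c, u, v, w}
    have h2 : ({c, u, v, w} : Set V).ncard ≤ 4 := by
      have : ({c, u, v, w} : Set V) = (({c, u, v, w} : Finset V) : Set V) := by simp
      rw [this, Set.ncard_coe_finset]
      exact Finset.card_le_four
    omega

/-- A deletion set of a graph that agrees with `G` on `X` contains an edge of each obstruction of
the packing. -/
theorem Packing.le_card {G H : SimpleGraph V} {X : Set V} {m : ℕ} (h : Packing G X m)
    (hH : ∀ u ∈ X, ∀ v ∈ X, H.Adj u v ↔ G.Adj u v) (S : Finset (Sym2 V))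
    (hS : ∀ c u v w, ¬ Obstruction (H.deleteEdges (S : Set (Sym2 V))) c u v w) :
    ∃ F ⊆ S, F.card = m ∧ ∀ e ∈ F, ∀ a ∈ e, a ∈ X := by
  classical
  induction h with
  | empty => exact ⟨∅, by simp, by simp, by simp⟩
  | @extend X m c u v w h ho he ih =>
    obtain ⟨F, hF, hm, hX⟩ := ih fun u hu v hv => hH u (Or.inl hu) v (Or.inl hv)
    obtain ⟨e, heS, heX, heY⟩ : ∃ e ∈ S, (¬ ∀ a ∈ e, a ∈ X) ∧
        ∀ a ∈ e, a ∈ ({c, u, v, w} : Set V) := by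
      by_contra! hno
      have hno' : ∀ a b, a ∈ ({c, u, v, w} : Set V) → b ∈ ({c, u, v, w} : Set V) →
          ¬ (a ∈ X ∧ b ∈ X) → s(a, b) ∉ S := by
        intro a b ha hb hab hs
        obtain ⟨z, hz, hz'⟩ := hno _ hs (by
          simp only [Sym2.mem_iff, exists_eq_or_imp, exists_eq_left]; tauto)
        simp only [Sym2.mem_iff] at hz
        rcases hz with rfl | rfl <;> contradiction
      apply hS c u v w
      have q1 : c ∈ ({c, u, v, w} : Set V) := by simp
      have q2 : u ∈ ({c, u, v, w} : Set V) := by simp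
      have q3 : v ∈ ({c, u, v, w} : Set V) := by simp
      have q4 : w ∈ ({c, u, v, w} : Set V) := by simp
      have e1 := hH c (Or.inr q1) u (Or.inr q2)
      have e2 := hH c (Or.inr q1) v (Or.inr q3)
      have e3 := hH c (Or.inr q1) w (Or.inr q4)
      have e4 := hH u (Or.inr q2) v (Or.inr q3)
      have e5 := hH u (Or.inr q2) w (Or.inr q4)
      have e6 := hH v (Or.inr q3) w (Or.inr q4)
      have f1 := hno' c u q1 q2
      have f2 := hno' c v q1 q3
      have f3 := hno' c w q1 q4
      have f4 := hno' u v q2 q3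
      have f6 := hno' v w q3 q4
      simp only [Obstruction, HasEdgeIn, SimpleGraph.deleteEdges_adj, Finset.mem_coe,
        e1, e2, e3, e4, e5, e6] at ho he ⊢
      clear hno hno' hS hX hF ih hH e1 e2 e3 e4 e5 e6 q1 q2 q3 q4 h
      grind
    refine ⟨insert e F, Finset.insert_subset heS hF, ?_, ?_⟩
    · rw [Finset.card_insert_of_notMem, hm]
      exact fun h => heX (hX e h)
    · intro e' he' a ha
      rcases Finset.mem_insert.1 he' with rfl | h
      · exact Or.inr (heY a ha)
      · exact Or.inl (hX e' h a ha)

theorem Packing.not_deletable {G H : SimpleGraph V} {X : Set V} {m k : ℕ} (h : Packing G X m)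
    (hH : ∀ u ∈ X, ∀ v ∈ X, H.Adj u v ↔ G.Adj u v) (hk : k < m) : ¬ Deletable H k := by
  rintro ⟨S, -, hc, hS⟩
  obtain ⟨F, hF, rfl, -⟩ := h.le_card hH S hS
  have := Finset.card_le_card hF
  omega

end Obstructions

/-! ### The structure of a graph around a modulator -/

section Modulator

variable {V : Type*}

/-- Every obstruction of `G` has an edge with both ends in `X`. -/
def IsModulator (G : SimpleGraph V) (X : Set V) : Prop :=
  ∀ c u v w, Obstruction G c u v w → HasEdgeIn G X c u v w

/-- `u` and `v` span an edge outside `X`, and no vertex of `X` is adjacent to both of them. The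
maximal clique that contains such an edge is disjoint from `X`. -/
def Detached (G : SimpleGraph V) (X : Set V) (u v : V) : Prop :=
  G.Adj u v ∧ u ∉ X ∧ v ∉ X ∧ ∀ x ∈ X, ¬ (G.Adj x u ∧ G.Adj x v)

theorem Detached.symm {G : SimpleGraph V} {X : Set V} {u v : V} (h : Detached G X u v) :
    Detached G X v u :=
  ⟨h.1.symm, h.2.2.1, h.2.1, fun x hx hh => h.2.2.2 x hx hh.symm⟩

variable {G : SimpleGraph V} {X : Set V}

namespace IsModulator

/-- The common neighbours of an edge outside the modulator form a clique. -/
theorem adj_of_common (hX : IsModulator G X) {p q s t : V} (hp : p ∉ X) (hq : q ∉ X)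
    (hpq : G.Adj p q) (hps : G.Adj p s) (hpt : G.Adj p t) (hqs : G.Adj q s) (hqt : G.Adj q t)
    (hst : s ≠ t) : G.Adj s t := by
  by_contra h
  have := hX p s q t ⟨hps, hpq, hpt, hst, h, Or.inl ⟨hqs.symm, hqt⟩⟩
  unfold HasEdgeIn at this
  tauto

/-- Outside the modulator, the common neighbours of an edge with one end outside the modulator
form a clique. -/
theorem adj_of_common' (hX : IsModulator G X) {x q s t : V} (hq : q ∉ X) (hs : s ∉ X) (ht : t ∉ X)
    (hxq : G.Adj x q) (hxs : G.Adj x s) (hxt : G.Adj x t) (hqs : G.Adj q s) (hqt : G.Adj q t)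
    (hst : s ≠ t) : G.Adj s t := by
  by_contra h
  have := hX q s x t ⟨hqs, hxq.symm, hqt, hst, h, Or.inl ⟨hxs.symm, hxt⟩⟩
  unfold HasEdgeIn at this
  tauto

/-- A vertex outside the modulator is not the centre of a claw. -/
theorem adj_of_three (hX : IsModulator G X) {w u v t : V} (hw : w ∉ X) (hu : G.Adj w u)
    (hv : G.Adj w v) (ht : G.Adj w t) (huv : u ≠ v) (hvt : v ≠ t) (hut : u ≠ t)
    (nuv : ¬ G.Adj u v) (nvt : ¬ G.Adj v t) : G.Adj u t := by
  by_contra h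
  have := hX w u v t ⟨hu, hv, ht, hut, h, Or.inr ⟨huv, hvt, nuv, nvt⟩⟩
  unfold HasEdgeIn at this
  tauto

/-- A claw has at least one leaf in the modulator. -/
theorem adj_of_three' (hX : IsModulator G X) {x u v t : V} (hu' : u ∉ X) (hv' : v ∉ X)
    (ht' : t ∉ X) (hu : G.Adj x u) (hv : G.Adj x v) (ht : G.Adj x t) (huv : u ≠ v) (hvt : v ≠ t)
    (hut : u ≠ t) (nuv : ¬ G.Adj u v) (nvt : ¬ G.Adj v t) : G.Adj u t := by
  by_contra h
  have := hX x u v t ⟨hu, hv, ht, hut, h, Or.inr ⟨huv, hvt, nuv, nvt⟩⟩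
  unfold HasEdgeIn at this
  tauto

/-- Detachedness spreads over the maximal clique of an edge. -/
theorem detached_of_triangle (hX : IsModulator G X) {u v w : V} (h : Detached G X u v)
    (hu : G.Adj u w) (hv : G.Adj v w) : Detached G X u w := by
  have hw : w ∉ X := fun hw => h.2.2.2 w hw ⟨hu.symm, hv.symm⟩
  refine ⟨hu, h.2.1, hw, fun x hx hh => h.2.2.2 x hx ⟨hh.1, ?_⟩⟩
  exact hX.adj_of_common h.2.1 hw hu hh.1.symm h.1 hh.2.symm hv.symm
    (by rintro rfl; exact h.2.2.1 hx)

/-- Two detached neighbours of a vertex that has a neighbour in the modulator lie in the same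
maximal clique: otherwise there is a claw. -/
theorem adj_of_detached (hX : IsModulator G X) {x a u w : V} (hx : x ∈ X) (hxa : G.Adj x a)
    (hu : Detached G X a u) (hw : Detached G X a w) (huw : u ≠ w) : G.Adj u w := by
  refine hX.adj_of_three (v := x) hu.2.1 hu.1 hxa.symm hw.1 ?_ ?_ huw ?_ ?_
  · rintro rfl; exact hu.2.2.1 hx
  · rintro rfl; exact hw.2.2.1 hx
  · exact fun h => hu.2.2.2 x hx ⟨hxa, h.symm⟩
  · exact fun h => hw.2.2.2 x hx ⟨hxa, h⟩

theorem not_adj_of_detached (hX : IsModulator G X) {a u w : V} (hu : Detached G X a u)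
    (haw : G.Adj a w) (hw : ¬ Detached G X a w) : ¬ G.Adj u w :=
  fun h => hw (hX.detached_of_triangle hu haw h)

end IsModulator

theorem exists_mem_adj_of_not_detached {a u : V} (ha : a ∉ X) (hau : G.Adj a u)
    (hd : ¬ Detached G X a u) : u ∈ X ∨ ∃ x ∈ X, G.Adj x a ∧ G.Adj x u := by
  by_contra! h
  exact hd ⟨hau, ha, h.1, fun x hx hh => h.2 x hx hh.1 hh.2⟩

theorem exists_adj_of_not_detached {a u : V} (ha : a ∉ X) (hau : G.Adj a u)
    (hd : ¬ Detached G X a u) : ∃ x ∈ X, G.Adj x a := by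
  rcases exists_mem_adj_of_not_detached ha hau hd with h | ⟨x, hx, h, -⟩
  · exact ⟨u, h, hau.symm⟩
  · exact ⟨x, hx, h⟩

theorem IsModulator.not_detached_of_attached (hX : IsModulator G X) {v p q : V} (hp : G.Adj v p)
    (hq : G.Adj v q) (hdp : ¬ Detached G X v p) : ¬ Detached G X p q := fun hd =>
  hdp (hX.detached_of_triangle hd hp.symm hq.symm).symm

variable [LinearOrder V]

/-- For `u` in a maximal clique through `a`, the number of vertices outside `X` that are smaller
than `u` and lie in this clique. -/
noncomputable def lowCount (G : SimpleGraph V) (X : Set V) (a u : V) : ℕ :=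
  {w | w ∉ X ∧ w < u ∧ G.Adj w u ∧ (w = a ∨ G.Adj w a)}.ncard

/-- The vertices that stay in the detached maximal clique of `a`: the vertices of `A` and the
`T` smallest vertices. -/
def Stays (G : SimpleGraph V) (X A : Set V) (T : ℕ) (a u : V) : Prop :=
  u = a ∨ (Detached G X a u ∧ (u ∈ A ∨ lowCount G X a u < T))

/-- The reduced graph. It has the edges of `G` inside `X ∪ A`, and in the detached cliques of the
vertices `a` of `A` the edges between the vertices that stay. -/
def reduced (G : SimpleGraph V) (X A : Set V) (T : ℕ) : SimpleGraph V where
  Adj u v := G.Adj u v ∧ ((u ∈ X ∪ A ∧ v ∈ X ∪ A) ∨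
    ∃ a ∈ A, Stays G X A T a u ∧ Stays G X A T a v)
  symm := ⟨fun _ _ h => ⟨h.1.symm, h.2.imp And.symm fun ⟨a, ha, h⟩ => ⟨a, ha, h.symm⟩⟩⟩
  loopless := ⟨fun _ h => h.1.ne rfl⟩

theorem reduced_adj {A : Set V} {T : ℕ} {u v : V} :
    (reduced G X A T).Adj u v ↔ G.Adj u v ∧ ((u ∈ X ∪ A ∧ v ∈ X ∪ A) ∨
      ∃ a ∈ A, Stays G X A T a u ∧ Stays G X A T a v) :=
  Iff.rfl

theorem detached_of_stays (hX : IsModulator G X) {A : Set V} {T : ℕ} {a u v : V}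
    (huv : G.Adj u v) (hu : Stays G X A T a u) (hv : Stays G X A T a v) :
    Detached G X u v := by
  rcases hu with rfl | ⟨hu, -⟩
  · rcases hv with rfl | ⟨hv, -⟩
    · exact absurd rfl huv.ne
    · exact hv
  · rcases hv with rfl | ⟨hv, -⟩
    · exact hu.symm
    · exact hX.detached_of_triangle hu.symm huv hv.1

theorem reduced_adj_of_mem {A : Set V} {T : ℕ} {u v : V} (hu : u ∈ X ∪ A) (hv : v ∈ X ∪ A) :
    (reduced G X A T).Adj u v ↔ G.Adj u v := by
  simp [reduced_adj, hu, hv]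

/-- The edges of the reduced graph that are not detached lie inside `X ∪ A`. -/
theorem mem_of_reduced_adj (hX : IsModulator G X) {A : Set V} {T : ℕ} {u v : V}
    (h : (reduced G X A T).Adj u v) (hd : ¬ Detached G X u v) : u ∈ X ∪ A ∧ v ∈ X ∪ A := by
  rcases h with ⟨h, h' | ⟨a, -, h1, h2⟩⟩
  · exact h'
  · exact absurd (detached_of_stays hX h h1 h2) hd

theorem lowCount_congr (hX : IsModulator G X) {a b u : V} (hau : Detached G X a u)
    (hbu : Detached G X b u) (hab : Detached G X a b) : lowCount G X a u = lowCount G X b u := by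
  have key : ∀ {a b : V}, Detached G X a u → Detached G X b u → Detached G X a b →
      ∀ w, w ∉ X → G.Adj w u → (w = a ∨ G.Adj w a) → (w = b ∨ G.Adj w b) := by
    intro a b hau hbu hab w hw hwu h
    rcases h with rfl | h
    · exact Or.inr hab.1
    · by_cases hwb : w = b
      · exact Or.inl hwb
      · exact Or.inr (hX.adj_of_common hau.2.1 hau.2.2.1 hau.1 h.symm hab.1 hwu.symm hbu.1.symm hwb)
  unfold lowCount
  congr 1
  ext w
  constructor
  · rintro ⟨h1, h2, h3, h4⟩
    exact ⟨h1, h2, h3, key hau hbu hab w h1 h3 h4⟩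
  · rintro ⟨h1, h2, h3, h4⟩
    exact ⟨h1, h2, h3, key hbu hau hab.symm w h1 h3 h4⟩

theorem stays_of_stays (hX : IsModulator G X) {A : Set V} {T : ℕ} {a b u v : V}
    (ha : Stays G X A T a u) (hb : b = u ∨ Detached G X b u) (hav : Stays G X A T a v)
    (huv : G.Adj u v) (hbv : b = v ∨ Detached G X b v) (haA : a ∈ A) : Stays G X A T b v := by
  have huv' := detached_of_stays hX huv ha hav
  rcases hbv with rfl | hbv
  · exact Or.inl rfl
  refine Or.inr ⟨hbv, ?_⟩
  rcases hav with rfl | ⟨hav, h | h⟩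
  · exact Or.inl haA
  · exact Or.inl h
  by_cases hab : a = b
  · subst hab; exact Or.inr h
  have hab' : Detached G X a b := by
    rcases ha with rfl | ⟨hau, -⟩
    · rcases hb with rfl | hb
      · exact absurd rfl hab
      · exact hb.symm
    · rcases hb with rfl | hb
      · exact hau
      · have : G.Adj a b := hX.adj_of_common huv'.2.1 huv'.2.2.1 huv'.1 hau.1.symm hb.1.symm
          hav.1.symm hbv.1.symm hab
        exact hX.detached_of_triangle hau this hb.1.symm
  right
  rwa [← lowCount_congr hX hav hbv hab']

/-- Two neighbours in the reduced graph of one vertex are adjacent in the reduced graph if they are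
adjacent in the original graph. -/
theorem reduced_locally_induced (hX : IsModulator G X) {A : Set V} {T : ℕ}
    {v u w : V} (hu : (reduced G X A T).Adj v u) (hw : (reduced G X A T).Adj v w)
    (huw : G.Adj u w) : (reduced G X A T).Adj u w := by
  -- One of the edges at `v` lies inside `X ∪ A`, the other one in a detached clique.
  have mixed : ∀ {u w : V}, G.Adj v u → G.Adj v w → G.Adj u w → v ∈ X ∪ A → u ∈ X ∪ A →
      (∃ a ∈ A, Stays G X A T a v ∧ Stays G X A T a w) → (reduced G X A T).Adj u w := by
    rintro u w hvu hvw huw hv hu ⟨a, ha, sv, sw⟩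
    have hd := detached_of_stays hX hvw sv sw
    have hvu' := hX.detached_of_triangle hd hvu huw.symm
    have huA : u ∈ A := hu.resolve_left hvu'.2.2.1
    refine ⟨huw, Or.inr ⟨u, huA, Or.inl rfl, ?_⟩⟩
    exact stays_of_stays hX sv (Or.inr hvu'.symm) sw hvw
      (Or.inr (hX.detached_of_triangle hvu'.symm huw hvw)) ha
  obtain ⟨hvu, ⟨hv, hu'⟩ | ⟨a, ha, sv, su⟩⟩ := hu
  · obtain ⟨hvw, ⟨hv', hw'⟩ | h⟩ := hw
    · exact ⟨huw, Or.inl ⟨hu', hw'⟩⟩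
    · exact mixed hvu hvw huw hv hu' h
  · obtain ⟨hvw, ⟨hv', hw'⟩ | ⟨b, hb, sv', sw⟩⟩ := hw
    · exact (mixed hvw hvu huw.symm hv' hw' ⟨a, ha, sv, su⟩).symm
    · refine ⟨huw, Or.inr ⟨a, ha, su, ?_⟩⟩
      have hd := detached_of_stays hX hvu sv su
      have hvw' := hX.detached_of_triangle hd hvw huw
      refine stays_of_stays hX sv' (sv.imp Eq.symm And.left) sw hvw ?_ hb
      rcases sv with rfl | ⟨hav, -⟩
      · exact Or.inr hvw'
      · by_cases haw : a = w
        · exact Or.inl haw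
        · rcases su with rfl | ⟨hau, -⟩
          · exact Or.inr (hX.detached_of_triangle hav huw hvw)
          · have : G.Adj a w := hX.adj_of_common hd.2.1 hd.2.2.1 hd.1 hav.1.symm hvw hau.1.symm
              huw haw
            exact Or.inr (hX.detached_of_triangle hav this hvw)

end Modulator

/-! ### Solutions of the reduced graph solve the original graph -/

section Restore

variable {V : Type*}

/-- The set `A` keeps enough of the neighbourhood of the modulator `X`: a neighbour `a` of `X` that
is not in `A` has at least `T` neighbours in `A` in each of its cliques attached to `X`, and there
is only one such clique. -/
structure IsKeptSet (G : SimpleGraph V) (X A : Set V) (T : ℕ) : Prop where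
  modulator : IsModulator G X
  notMem : ∀ a ∈ A, a ∉ X
  exists_adj : ∀ a ∈ A, ∃ x ∈ X, G.Adj x a
  many : ∀ a, a ∉ X → a ∉ A → ∀ x ∈ X, G.Adj x a → T ≤ {w | w ∈ A ∧ G.Adj w a ∧ G.Adj w x}.ncard
  single : ∀ a, a ∉ X → a ∉ A → ∀ x ∈ X, ∀ x' ∈ X, ∀ q, q ∉ X →
    G.Adj x a → G.Adj x' a → G.Adj q a → G.Adj q x → G.Adj q x'

theorem ncard_pair_le {V : Type*} (a b : V) : ({a, b} : Set V).ncard ≤ 2 :=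
  (Set.ncard_insert_le a {b}).trans (by simp)

theorem ncard_triple_le {V : Type*} (a b c : V) : ({a, b, c} : Set V).ncard ≤ 3 :=
  (Set.ncard_insert_le a {b, c}).trans (Nat.succ_le_succ (ncard_pair_le b c))

/-- A set of more than `2 * k + d` vertices has a vertex that is not touched by given `k` edges and
avoids `d` given vertices. -/
theorem exists_untouched [Finite V] {k d : ℕ} {S : Finset (Sym2 V)} (hk : S.card ≤ k) {Q F : Set V}
    (hF : F.ncard ≤ d) (hQ : 2 * k + d < Q.ncard) : ∃ w ∈ Q, w ∉ F ∧ ∀ z, s(w, z) ∉ S := by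
  classical
  by_contra! h
  have hsub : Q ⊆ F ∪ ((S.biUnion Sym2.toFinset : Finset V) : Set V) := by
    intro w hw
    by_cases hwF : w ∈ F
    · exact Or.inl hwF
    · obtain ⟨z, hz⟩ := h w hw hwF
      right
      simp only [Finset.mem_coe, Finset.mem_biUnion, Sym2.mem_toFinset]
      exact ⟨_, hz, Sym2.mem_mk_left _ _⟩
  have h1 := Set.ncard_le_ncard hsub (Set.toFinite _)
  have h2 := Set.ncard_union_le F ((S.biUnion Sym2.toFinset : Finset V) : Set V)
  have h3 : (S.biUnion Sym2.toFinset).card ≤ S.card * 2 := by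
    refine Finset.card_biUnion_le_card_mul _ _ _ fun e _ => ?_
    rw [Sym2.card_toFinset]
    split <;> omega
  rw [Set.ncard_coe_finset] at h2
  omega

variable {G : SimpleGraph V} {X A : Set V} {T : ℕ}

namespace IsKeptSet

/-- The attached neighbours of a vertex that is not kept are adjacent to all the kept vertices of
its attached clique. -/
theorem adj_kept (h : IsKeptSet G X A T) {a x w u : V} (ha : a ∉ X) (haA : a ∉ A) (hx : x ∈ X)
    (hxa : G.Adj x a) (hw : w ∈ A) (hwa : G.Adj w a) (hwx : G.Adj w x) (hau : G.Adj a u)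
    (hd : ¬ Detached G X a u) (huw : u ≠ w) : G.Adj u w := by
  by_cases hu : u ∈ X
  · exact (h.single a ha haA x hx u hu w (h.notMem w hw) hxa hau.symm hwa hwx).symm
  · obtain ⟨x', hx', hx'a, hx'u⟩ := (exists_mem_adj_of_not_detached ha hau hd).resolve_left hu
    have hwx' := h.single a ha haA x hx x' hx' w (h.notMem w hw) hxa hx'a hwa hwx
    exact h.modulator.adj_of_common' ha hu (h.notMem w hw) hx'a hx'u hwx'.symm hau hwa.symm huw

section Solution

variable [LinearOrder V]

variable (G X A T) in
/-- A kept vertex is bad for a set `S` of deleted edges if its remaining attached neighbours do not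
form a clique. -/
def Bad (S : Finset (Sym2 V)) (a : V) : Prop :=
  a ∈ A ∧ ∃ p p', p ∈ X ∪ A ∧ p' ∈ X ∪ A ∧ p ≠ p' ∧ ¬ Detached G X a p ∧ ¬ Detached G X a p' ∧
    ((reduced G X A T).deleteEdges (S : Set (Sym2 V))).Adj a p ∧
    ((reduced G X A T).deleteEdges (S : Set (Sym2 V))).Adj a p' ∧
    ¬ ((reduced G X A T).deleteEdges (S : Set (Sym2 V))).Adj p p'

open Classical in
variable (G X A T) in
/-- The part of a solution of the reduced graph that suffices for the original graph: a detached
edge is deleted only if one of its ends is bad. -/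
noncomputable def neededEdges (S : Finset (Sym2 V)) : Finset (Sym2 V) :=
  S.filter fun e => ¬ ∃ u v, e = s(u, v) ∧ Detached G X u v ∧ ¬ Bad G X A T S u ∧ ¬ Bad G X A T S v

theorem neededEdges_adj {S : Finset (Sym2 V)} {u v : V} :
    (G.deleteEdges (neededEdges G X A T S : Set (Sym2 V))).Adj u v ↔ G.Adj u v ∧
      (s(u, v) ∈ S → Detached G X u v ∧ ¬ Bad G X A T S u ∧ ¬ Bad G X A T S v) := by
  classical
  have : (∃ a b, s(u, v) = s(a, b) ∧ Detached G X a b ∧ ¬ Bad G X A T S a ∧ ¬ Bad G X A T S b) ↔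
      Detached G X u v ∧ ¬ Bad G X A T S u ∧ ¬ Bad G X A T S v := by
    constructor
    · rintro ⟨a, b, hab, h1, h2, h3⟩
      rcases Sym2.eq_iff.1 hab with ⟨rfl, rfl⟩ | ⟨rfl, rfl⟩
      · exact ⟨h1, h2, h3⟩
      · exact ⟨h1.symm, h3, h2⟩
    · exact fun hh => ⟨u, v, rfl, hh⟩
  rw [SimpleGraph.deleteEdges_adj, neededEdges, Finset.mem_coe, Finset.mem_filter, this]
  tauto

theorem deleteEdges_adj_iff (h : IsKeptSet G X A T) {S : Finset (Sym2 V)} {v p q : V}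
    (hp : p ∈ X ∪ A) (hq : q ∈ X ∪ A) (hvp : G.Adj v p) (hvq : G.Adj v q)
    (hdp : ¬ Detached G X v p) :
    (G.deleteEdges (neededEdges G X A T S : Set (Sym2 V))).Adj p q ↔
      ((reduced G X A T).deleteEdges (S : Set (Sym2 V))).Adj p q := by
  rw [neededEdges_adj, SimpleGraph.deleteEdges_adj, reduced_adj_of_mem hp hq]
  have := h.modulator.not_detached_of_attached hvp hvq hdp
  exact and_congr_right fun _ => ⟨fun hh hs => this (hh hs).1, fun hh hs => absurd hs hh⟩

variable [Finite V] {S : Finset (Sym2 V)} {k : ℕ}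

/-- A solution contains all the detached edges at a bad vertex, because each of them that stays in
the reduced graph is a leg of a claw. If some of them did not stay, there would be at least `T`
others. -/
theorem mem_of_bad (h : IsKeptSet G X A T) (hk : S.card ≤ k) (hT : 2 * k + 6 ≤ T)
    (hS : ∀ c u v w, ¬ Obstruction ((reduced G X A T).deleteEdges (S : Set (Sym2 V))) c u v w)
    {a q : V} (ha : Bad G X A T S a) (haq : Detached G X a q) : s(a, q) ∈ S := by
  classical
  obtain ⟨haA, p, p', hp, hp', hpp', hdp, hdp', hap, hap', hn⟩ := ha
  have hred : ∀ {u v}, ((reduced G X A T).deleteEdges (S : Set (Sym2 V))).Adj u v → G.Adj u v :=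
    fun hh => (SimpleGraph.deleteEdges_adj.1 hh).1.1
  have hstay : ∀ q, Detached G X a q → Stays G X A T a q → s(a, q) ∈ S := by
    intro q haq hq
    by_contra hmem
    have h1 := h.modulator.not_adj_of_detached haq (hred hap) hdp
    have h2 := h.modulator.not_adj_of_detached haq (hred hap') hdp'
    refine hS a p q p' ⟨hap, ?_, hap', hpp', hn, Or.inr ⟨?_, ?_, ?_, ?_⟩⟩
    · rw [SimpleGraph.deleteEdges_adj]
      exact ⟨⟨haq.1, Or.inr ⟨a, haA, Or.inl rfl, hq⟩⟩, hmem⟩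
    · rintro rfl; exact hdp haq
    · rintro rfl; exact hdp' haq
    · exact fun hh => h1 (hred hh).symm
    · exact fun hh => h2 (hred hh)
  by_cases hq : Stays G X A T a q
  · exact hstay q haq hq
  exfalso
  obtain ⟨x, hx, hxa⟩ := h.exists_adj a haA
  have hqA : ¬ lowCount G X a q < T := fun hh => hq (Or.inr ⟨haq, Or.inr hh⟩)
  -- The vertices of the clique below `q`; at least `T` of them have a small position in it.
  set D : Set V := {w | w ∉ X ∧ w < q ∧ G.Adj w q ∧ (w = a ∨ G.Adj w a)} with hD
  have hDT : T ≤ D.ncard := not_lt.1 hqA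
  have hDdet : ∀ w ∈ D, w ≠ a → Detached G X a w := by
    rintro w ⟨hw, -, hwq, hwa⟩ hne
    exact h.modulator.detached_of_triangle haq (hwa.resolve_left hne).symm hwq.symm
  have hall : ∀ w ∈ D, w ≠ a → s(a, w) ∈ S := by
    by_contra! hex
    obtain ⟨w, ⟨hw, hwa, hws⟩, hmin⟩ :=
      (Set.toFinite {w | w ∈ D ∧ w ≠ a ∧ s(a, w) ∉ S}).exists_minimal
        (by obtain ⟨w, h1, h2, h3⟩ := hex; exact ⟨w, h1, h2, h3⟩)
    have hlow : T ≤ lowCount G X a w := by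
      by_contra hlt
      exact hws (hstay w (hDdet w hw hwa) (Or.inr ⟨hDdet w hw hwa, Or.inr (not_le.1 hlt)⟩))
    set L : Set V := {z | z ∉ X ∧ z < w ∧ G.Adj z w ∧ (z = a ∨ G.Adj z a)} with hL
    have hLD : L ⊆ D := by
      rintro z ⟨hz, hzw, hzw', hza⟩
      refine ⟨hz, hzw.trans hw.2.1, ?_, hza⟩
      by_cases hza' : z = a
      · rw [hza']; exact haq.1
      · have hd := hDdet w hw hwa
        exact h.modulator.adj_of_common hd.2.1 hd.2.2.1 hd.1 (hza.resolve_left hza').symm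
          haq.1 hzw'.symm hw.2.2.1 (hzw.trans hw.2.1).ne
    have hLS : ∀ z ∈ L, z ≠ a → s(a, z) ∈ S := by
      intro z hz hza
      by_contra hzS
      have := hmin ⟨hLD hz, hza, hzS⟩ hz.2.1.le
      exact absurd (lt_of_lt_of_le hz.2.1 this) (lt_irrefl _)
    obtain ⟨z, hz, hza, hzS⟩ := exists_untouched (F := {a}) (d := 1) hk (by simp) (Q := L)
      (by have : T ≤ L.ncard := hlow
          omega)
    exact hzS a (by rw [Sym2.eq_swap]; exact hLS z hz hza)
  obtain ⟨z, hz, hza, hzS⟩ := exists_untouched (F := {a}) (d := 1) hk (by simp) (Q := D) (by omega)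
  exact hzS a (by rw [Sym2.eq_swap]; exact hall z hz hza)

/-- The attached neighbours of a vertex that is not kept form a clique that no solution touches. -/
theorem adj_of_attached (h : IsKeptSet G X A T) (hk : S.card ≤ k) (hT : 2 * k + 6 ≤ T)
    (hsub : (S : Set (Sym2 V)) ⊆ (reduced G X A T).edgeSet)
    (hS : ∀ c u v w, ¬ Obstruction ((reduced G X A T).deleteEdges (S : Set (Sym2 V))) c u v w)
    {a u w : V} (ha : a ∉ X) (haA : a ∉ A) (hau : G.Adj a u) (haw : G.Adj a w)
    (hu : ¬ Detached G X a u) (hw : ¬ Detached G X a w) (huw : u ≠ w) :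
    G.Adj u w ∧ s(u, w) ∉ S := by
  obtain ⟨x, hx, hxa⟩ := exists_adj_of_not_detached ha hau hu
  have hQ := h.many a ha haA x hx hxa
  set Q : Set V := {w | w ∈ A ∧ G.Adj w a ∧ G.Adj w x} with hQdef
  have hF : ({u, w} : Set V).ncard ≤ 2 := ncard_pair_le u w
  obtain ⟨y, ⟨hyA, hya, hyx⟩, hyF, hyS⟩ := exists_untouched (F := {u, w}) (d := 2) hk hF (Q := Q)
    (by omega)
  simp only [Set.mem_insert_iff, Set.mem_singleton_iff, not_or] at hyF
  have hyu := h.adj_kept ha haA hx hxa hyA hya hyx hau hu (Ne.symm hyF.1)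
  have hyw := h.adj_kept ha haA hx hxa hyA hya hyx haw hw (Ne.symm hyF.2)
  have hadj : G.Adj u w := h.modulator.adj_of_common ha (h.notMem y hyA) hya.symm hau haw hyu.symm
    hyw.symm huw
  refine ⟨hadj, fun hmem => ?_⟩
  have hnd : ¬ Detached G X u w := fun hd =>
    hu (h.modulator.detached_of_triangle hd hau.symm haw.symm).symm
  obtain ⟨hu', hw'⟩ := mem_of_reduced_adj h.modulator (hsub hmem) hnd
  have hF' : ({u, w, y} : Set V).ncard ≤ 3 := ncard_triple_le u w y
  obtain ⟨z, ⟨hzA, hza, hzx⟩, hzF, hzS⟩ := exists_untouched (F := {u, w, y}) (d := 3) hk hF'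
    (Q := Q) (by omega)
  simp only [Set.mem_insert_iff, Set.mem_singleton_iff, not_or] at hzF
  have hzu := h.adj_kept ha haA hx hxa hzA hza hzx hau hu (Ne.symm hzF.1)
  have hzw := h.adj_kept ha haA hx hxa hzA hza hzx haw hw (Ne.symm hzF.2.1)
  have hyz := h.adj_kept ha haA hx hxa hzA hza hzx hya.symm
    (fun hd => hd.2.2.2 x hx ⟨hxa, hyx.symm⟩) (Ne.symm hzF.2.2)
  have hK : ∀ {p q}, p ∈ X ∪ A → q ∈ X ∪ A → G.Adj p q → s(p, q) ∉ S →
      ((reduced G X A T).deleteEdges (S : Set (Sym2 V))).Adj p q := by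
    intro p q hp hq hpq hs
    rw [SimpleGraph.deleteEdges_adj, reduced_adj_of_mem hp hq]
    exact ⟨hpq, hs⟩
  refine hS y u z w ⟨hK (Or.inr hyA) hu' hyu.symm (hyS _), hK (Or.inr hyA) (Or.inr hzA) hyz (hyS _),
    hK (Or.inr hyA) hw' hyw.symm (hyS _), huw, ?_, Or.inl ⟨?_, ?_⟩⟩
  · rw [SimpleGraph.deleteEdges_adj]
    exact fun hh => hh.2 hmem
  · exact (hK (Or.inr hzA) hu' hzu.symm (hzS _)).symm
  · exact hK (Or.inr hzA) hw' hzw.symm (hzS _)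

/-- An attached neighbour of `v` that is not kept can be exchanged for a kept one with the same
remaining adjacencies to two given attached neighbours `p` and `q`. -/
theorem exists_exchange (h : IsKeptSet G X A T) (hk : S.card ≤ k) (hT : 2 * k + 6 ≤ T)
    (hsub : (S : Set (Sym2 V)) ⊆ (reduced G X A T).edgeSet)
    {v u p q : V} (hvu : G.Adj v u) (hdu : ¬ Detached G X v u)
    (hu : u ∉ X ∪ A) (hvp : G.Adj v p) (hpu : p ≠ u)
    (hvq : G.Adj v q) (hqu : q ≠ u) :
    ∃ u' ∈ A, u' ≠ p ∧ u' ≠ q ∧ ¬ Detached G X v u' ∧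
      (G.deleteEdges (neededEdges G X A T S : Set (Sym2 V))).Adj v u' ∧
      ((G.deleteEdges (neededEdges G X A T S : Set (Sym2 V))).Adj u' p ↔
        (G.deleteEdges (neededEdges G X A T S : Set (Sym2 V))).Adj u p) ∧
      ((G.deleteEdges (neededEdges G X A T S : Set (Sym2 V))).Adj u' q ↔
        (G.deleteEdges (neededEdges G X A T S : Set (Sym2 V))).Adj u q) := by
  have huX : u ∉ X := fun hh => hu (Or.inl hh)
  have huA : u ∉ A := fun hh => hu (Or.inr hh)
  have hduv : ¬ Detached G X u v := fun hh => hdu hh.symm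
  obtain ⟨x, hx, hxu⟩ := exists_adj_of_not_detached huX hvu.symm hduv
  have hQ := h.many u huX huA x hx hxu
  set Q : Set V := {w | w ∈ A ∧ G.Adj w u ∧ G.Adj w x} with hQdef
  -- A vertex that is not adjacent to `u` has at most one neighbour in the clique.
  have hone : ∀ p, p ≠ u → {w | w ∈ Q ∧ G.Adj w p ∧ ¬ G.Adj p u}.ncard ≤ 1 := by
    intro p hpu
    rw [Set.ncard_le_one (Set.toFinite _)]
    rintro w ⟨⟨hwA, hwu, hwx⟩, hwp, hn⟩ z ⟨⟨hzA, hzu, hzx⟩, hzp, -⟩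
    by_contra hwz
    have hadj : G.Adj w z := h.adj_kept huX huA hx hxu hzA hzu hzx hwu.symm
      (fun hd => hd.2.2.2 x hx ⟨hxu, hwx.symm⟩) hwz
    exact hn (h.modulator.adj_of_common (h.notMem w hwA) (h.notMem z hzA) hadj hwp hwu hzp hzu hpu)
  have hF : ({v, p, q} ∪ {w | w ∈ Q ∧ G.Adj w p ∧ ¬ G.Adj p u} ∪
      {w | w ∈ Q ∧ G.Adj w q ∧ ¬ G.Adj q u} : Set V).ncard ≤ 5 := by
    have h1 := Set.ncard_union_le ({v, p, q} ∪ {w | w ∈ Q ∧ G.Adj w p ∧ ¬ G.Adj p u})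
      {w | w ∈ Q ∧ G.Adj w q ∧ ¬ G.Adj q u}
    have h2 := Set.ncard_union_le {v, p, q} {w | w ∈ Q ∧ G.Adj w p ∧ ¬ G.Adj p u}
    have h3 : ({v, p, q} : Set V).ncard ≤ 3 := ncard_triple_le v p q
    have h4 := hone p hpu
    have h5 := hone q hqu
    omega
  -- Besides the `2 * k` touched vertices, five vertices are excluded; this determines `T`.
  obtain ⟨y, hyQ, hyF, hyS⟩ := exists_untouched hk hF (Q := Q) (by omega)
  obtain ⟨hyA, hyu, hyx⟩ := id hyQ
  simp only [Set.mem_union, Set.mem_insert_iff, Set.mem_singleton_iff, Set.mem_ofPred_eq, not_or]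
    at hyF
  obtain ⟨⟨⟨hyv, hyp, hyq⟩, hyp'⟩, hyq'⟩ := hyF
  have hvy : G.Adj v y := h.adj_kept huX huA hx hxu hyA hyu hyx hvu.symm hduv (Ne.symm hyv)
  have hdy : ¬ Detached G X v y := fun hd => hdu (h.modulator.detached_of_triangle hd hvu hyu)
  refine ⟨y, hyA, hyp, hyq, hdy, ?_, ?_⟩
  · rw [neededEdges_adj]
    exact ⟨hvy, fun hs => absurd (by rwa [Sym2.eq_swap]) (hyS v)⟩
  have hsame : ∀ p, G.Adj v p → y ≠ p → ¬ (y ∈ Q ∧ G.Adj y p ∧ ¬ G.Adj p u) →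
      ((G.deleteEdges (neededEdges G X A T S : Set (Sym2 V))).Adj y p ↔
        (G.deleteEdges (neededEdges G X A T S : Set (Sym2 V))).Adj u p) := by
    intro p hvp hyp hyp'
    rw [neededEdges_adj, neededEdges_adj]
    have hsu : G.Adj u p → s(u, p) ∉ S := by
      intro hup hs
      exact hu (mem_of_reduced_adj h.modulator (hsub hs)
        (h.modulator.not_detached_of_attached hvu hvp hdu)).1
    constructor
    · rintro ⟨hy, -⟩
      have hpu : G.Adj p u := by
        by_contra hn
        exact hyp' ⟨hyQ, hy, hn⟩
      exact ⟨hpu.symm, fun hs => absurd hs (hsu hpu.symm)⟩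
    · rintro ⟨hup, -⟩
      have hdp : ¬ Detached G X u p := h.modulator.not_detached_of_attached hvu hvp hdu
      refine ⟨(h.adj_kept huX huA hx hxu hyA hyu hyx hup hdp (Ne.symm hyp)).symm, ?_⟩
      exact fun hs => absurd hs (hyS p)
  exact ⟨hsame p hvp hyp hyp', hsame q hvq hyq hyq'⟩

/-- No obstruction has its centre in `X ∪ A` and attached neighbours of the centre as the other
vertices. -/
theorem not_obstruction_of_attached (h : IsKeptSet G X A T) (hk : S.card ≤ k) (hT : 2 * k + 6 ≤ T)
    (hsub : (S : Set (Sym2 V)) ⊆ (reduced G X A T).edgeSet)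
    (hS : ∀ c u v w, ¬ Obstruction ((reduced G X A T).deleteEdges (S : Set (Sym2 V))) c u v w)
    {c u v w : V} (hc : c ∈ X ∪ A) (hu : ¬ Detached G X c u) (hv : ¬ Detached G X c v)
    (hw : ¬ Detached G X c w) :
    ¬ Obstruction (G.deleteEdges (neededEdges G X A T S : Set (Sym2 V))) c u v w := by
  have hG : ∀ {p q}, (G.deleteEdges (neededEdges G X A T S : Set (Sym2 V))).Adj p q → G.Adj p q :=
    fun hh => (SimpleGraph.deleteEdges_adj.1 hh).1
  have kept : ∀ {u v w : V}, ¬ Detached G X c u → ¬ Detached G X c v → ¬ Detached G X c w →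
      u ∈ X ∪ A → v ∈ X ∪ A → w ∈ X ∪ A →
      ¬ Obstruction (G.deleteEdges (neededEdges G X A T S : Set (Sym2 V))) c u v w := by
    rintro u v w hu hv hw hu' hv' hw' ho
    have hcu := hG ho.1
    have hcv := hG ho.2.1
    have hcw := hG ho.2.2.1
    have key : ∀ {p}, p ∈ X ∪ A → ¬ Detached G X c p →
        (G.deleteEdges (neededEdges G X A T S : Set (Sym2 V))).Adj c p →
        ((reduced G X A T).deleteEdges (S : Set (Sym2 V))).Adj c p := by
      intro p hp hd hcp
      rw [neededEdges_adj] at hcp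
      rw [SimpleGraph.deleteEdges_adj, reduced_adj_of_mem hc hp]
      exact ⟨hcp.1, fun hs => hd (hcp.2 hs).1⟩
    apply hS c u v w
    have e1 := h.deleteEdges_adj_iff (S := S) hu' hw' hcu hcw hu
    have e2 := h.deleteEdges_adj_iff (S := S) hu' hv' hcu hcv hu
    have e3 := h.deleteEdges_adj_iff (S := S) hv' hw' hcv hcw hv
    obtain ⟨h1, h2, h3, h4⟩ := ho
    rw [e1, e2, e3] at h4
    exact ⟨key hu' hu h1, key hv' hv h2, key hw' hw h3, h4⟩
  -- The vertices that are not kept are exchanged one after the other.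
  have kept₂ : ∀ {u v w : V}, ¬ Detached G X c u → ¬ Detached G X c v → ¬ Detached G X c w →
      u ∈ X ∪ A → v ∈ X ∪ A →
      ¬ Obstruction (G.deleteEdges (neededEdges G X A T S : Set (Sym2 V))) c u v w := by
    intro u v w hu hv hw hu' hv' ho
    by_cases hw' : w ∈ X ∪ A
    · exact kept hu hv hw hu' hv' hw' ho
    obtain ⟨y, hyA, hyu, hyv, hdy, hcy, eu, ev⟩ := h.exists_exchange (S := S) hk hT hsub
      (hG ho.2.2.1) hw hw' (hG ho.1) ho.2.2.2.1 (hG ho.2.1) ho.ne₂₃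
    refine kept hu hv hdy hu' hv' (Or.inr hyA) (u := u) (v := v) (w := y) ?_
    exact (ho.symm.exchange_first hcy hyv hyu ev eu).symm
  have kept₁ : ∀ {u v w : V}, ¬ Detached G X c u → ¬ Detached G X c v → ¬ Detached G X c w →
      u ∈ X ∪ A →
      ¬ Obstruction (G.deleteEdges (neededEdges G X A T S : Set (Sym2 V))) c u v w := by
    intro u v w hu hv hw hu' ho
    by_cases hv' : v ∈ X ∪ A
    · exact kept₂ hu hv hw hu' hv' ho
    obtain ⟨y, hyA, hyu, hyw, hdy, hcy, eu, ew⟩ := h.exists_exchange (S := S) hk hT hsub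
      (hG ho.2.1) hv hv' (hG ho.1) ho.ne₁₂ (hG ho.2.2.1) ho.ne₂₃.symm
    refine kept₂ hu hdy hw hu' (Or.inr hyA) (u := u) (v := y) (w := w) ?_
    exact ho.exchange_second hcy hyu hyw eu ew
  intro ho
  by_cases hu' : u ∈ X ∪ A
  · exact kept₁ hu hv hw hu' ho
  obtain ⟨y, hyA, hyv, hyw, hdy, hcy, ev, ew⟩ := h.exists_exchange (S := S) hk hT hsub
    (hG ho.1) hu hu' (hG ho.2.1) ho.ne₁₂.symm (hG ho.2.2.1) ho.2.2.2.1.symm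
  refine kept₁ hdy hv hw (Or.inr hyA) (u := y) (v := v) (w := w) ?_
  exact ho.exchange_first hcy hyv hyw ev ew

/-- The attached neighbours of a good kept vertex form a clique. -/
theorem adj_of_not_bad (h : IsKeptSet G X A T) (hk : S.card ≤ k) (hT : 2 * k + 6 ≤ T)
    (hsub : (S : Set (Sym2 V)) ⊆ (reduced G X A T).edgeSet)
    {c u w : V} (hc : c ∈ A) (hbad : ¬ Bad G X A T S c)
    (hcu : (G.deleteEdges (neededEdges G X A T S : Set (Sym2 V))).Adj c u)
    (hcw : (G.deleteEdges (neededEdges G X A T S : Set (Sym2 V))).Adj c w)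
    (hu : ¬ Detached G X c u) (hw : ¬ Detached G X c w) (huw : u ≠ w) :
    (G.deleteEdges (neededEdges G X A T S : Set (Sym2 V))).Adj u w := by
  have hG : ∀ {p q}, (G.deleteEdges (neededEdges G X A T S : Set (Sym2 V))).Adj p q → G.Adj p q :=
    fun hh => (SimpleGraph.deleteEdges_adj.1 hh).1
  have kept : ∀ {u w : V}, (G.deleteEdges (neededEdges G X A T S : Set (Sym2 V))).Adj c u →
      (G.deleteEdges (neededEdges G X A T S : Set (Sym2 V))).Adj c w →
      ¬ Detached G X c u → ¬ Detached G X c w → u ≠ w → u ∈ X ∪ A → w ∈ X ∪ A →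
      (G.deleteEdges (neededEdges G X A T S : Set (Sym2 V))).Adj u w := by
    intro u w hcu hcw hu hw huw hu' hw'
    have key : ∀ {p}, p ∈ X ∪ A → ¬ Detached G X c p →
        (G.deleteEdges (neededEdges G X A T S : Set (Sym2 V))).Adj c p →
        ((reduced G X A T).deleteEdges (S : Set (Sym2 V))).Adj c p := by
      intro p hp hd hcp
      rw [neededEdges_adj] at hcp
      rw [SimpleGraph.deleteEdges_adj, reduced_adj_of_mem (Or.inr hc) hp]
      exact ⟨hcp.1, fun hs => hd (hcp.2 hs).1⟩
    rw [h.deleteEdges_adj_iff (S := S) hu' hw' (hG hcu) (hG hcw) hu]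
    by_contra hn
    exact hbad ⟨hc, u, w, hu', hw', huw, hu, hw, key hu' hu hcu, key hw' hw hcw, hn⟩
  have kept₁ : ∀ {u w : V}, (G.deleteEdges (neededEdges G X A T S : Set (Sym2 V))).Adj c u →
      (G.deleteEdges (neededEdges G X A T S : Set (Sym2 V))).Adj c w →
      ¬ Detached G X c u → ¬ Detached G X c w → u ≠ w → u ∈ X ∪ A →
      (G.deleteEdges (neededEdges G X A T S : Set (Sym2 V))).Adj u w := by
    intro u w hcu hcw hu hw huw hu'
    by_cases hw' : w ∈ X ∪ A
    · exact kept hcu hcw hu hw huw hu' hw'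
    obtain ⟨y, hyA, hyu, -, hdy, hcy, eu, -⟩ := h.exists_exchange (S := S) hk hT hsub
      (hG hcw) hw hw' (hG hcu) huw (hG hcu) huw
    exact (eu.1 (kept hcu hcy hu hdy hyu.symm hu' (Or.inr hyA)).symm).symm
  by_cases hu' : u ∈ X ∪ A
  · exact kept₁ hcu hcw hu hw huw hu'
  obtain ⟨y, hyA, hyw, -, hdy, hcy, ew, -⟩ := h.exists_exchange (S := S) hk hT hsub
    (hG hcu) hu hu' (hG hcw) huw.symm (hG hcw) huw.symm
  exact ew.1 (kept₁ hcy hcw hdy hw hyw (Or.inr hyA))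

/-- The needed edges of a solution of the reduced graph form a solution of the original graph. -/
theorem not_obstruction (h : IsKeptSet G X A T) (hk : S.card ≤ k) (hT : 2 * k + 6 ≤ T)
    (hsub : (S : Set (Sym2 V)) ⊆ (reduced G X A T).edgeSet)
    (hS : ∀ c u v w, ¬ Obstruction ((reduced G X A T).deleteEdges (S : Set (Sym2 V))) c u v w)
    (c u v w : V) :
    ¬ Obstruction (G.deleteEdges (neededEdges G X A T S : Set (Sym2 V))) c u v w := by
  have hG : ∀ {p q}, (G.deleteEdges (neededEdges G X A T S : Set (Sym2 V))).Adj p q → G.Adj p q :=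
    fun hh => (SimpleGraph.deleteEdges_adj.1 hh).1
  have hdet : ∀ {p q}, Detached G X p q →
      ((G.deleteEdges (neededEdges G X A T S : Set (Sym2 V))).Adj p q ↔
        ¬ Bad G X A T S p ∧ ¬ Bad G X A T S q) := by
    intro p q hd
    rw [neededEdges_adj]
    constructor
    · rintro ⟨hpq, hs⟩
      constructor
      · intro hb
        exact (hs (h.mem_of_bad hk hT hS hb hd)).2.1 hb
      · intro hb
        have := h.mem_of_bad hk hT hS hb hd.symm
        rw [Sym2.eq_swap] at this
        exact (hs this).2.2 hb
    · exact fun hh => ⟨hd.1, fun _ => ⟨hd, hh⟩⟩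
  have hdetached : ∀ {x u w}, x ∈ X → G.Adj x c →
      (G.deleteEdges (neededEdges G X A T S : Set (Sym2 V))).Adj c u →
      (G.deleteEdges (neededEdges G X A T S : Set (Sym2 V))).Adj c w → u ≠ w →
      Detached G X c u → Detached G X c w →
      (G.deleteEdges (neededEdges G X A T S : Set (Sym2 V))).Adj u w := by
    intro x u w hx hxc hcu hcw huw hu hw
    have huw' := h.modulator.adj_of_detached hx hxc hu hw huw
    rw [hdet (h.modulator.detached_of_triangle hu.symm huw' hw.1)]
    exact ⟨((hdet hu).1 hcu).2, ((hdet hw).1 hcw).2⟩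
  by_cases hcX : c ∈ X
  · exact h.not_obstruction_of_attached hk hT hsub hS (Or.inl hcX) (fun hd => hd.2.1 hcX)
      (fun hd => hd.2.1 hcX) (fun hd => hd.2.1 hcX)
  by_cases hcA : c ∈ A
  · by_cases hbad : Bad G X A T S c
    · intro ho
      have hn : ∀ {p}, (G.deleteEdges (neededEdges G X A T S : Set (Sym2 V))).Adj c p →
          ¬ Detached G X c p := fun hp hd => ((hdet hd).1 hp).1 hbad
      exact h.not_obstruction_of_attached hk hT hsub hS (Or.inr hcA) (hn ho.1) (hn ho.2.1)
        (hn ho.2.2.1) ho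
    · obtain ⟨x, hx, hxc⟩ := h.exists_adj c hcA
      refine not_obstruction_of_two_cliques (Detached G X c) ?_ ?_ ?_ u v w
      · exact fun u w hcu hcw huw hu hw => hdetached hx hxc hcu hcw huw hu hw
      · exact fun u w hcu hcw huw hu hw =>
          h.adj_of_not_bad hk hT hsub hcA hbad hcu hcw hu hw huw
      · exact fun u w _ hcw hu hw huw =>
          h.modulator.not_adj_of_detached hu (hG hcw) hw (hG huw)
  by_cases hx : ∃ x ∈ X, G.Adj x c
  · obtain ⟨x, hx, hxc⟩ := hx
    refine not_obstruction_of_two_cliques (Detached G X c) ?_ ?_ ?_ u v w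
    · exact fun u w hcu hcw huw hu hw => hdetached hx hxc hcu hcw huw hu hw
    · intro u w hcu hcw huw hu hw
      obtain ⟨h1, h2⟩ := h.adj_of_attached hk hT hsub hS hcX hcA (hG hcu) (hG hcw) hu hw huw
      exact neededEdges_adj.2 ⟨h1, fun hs => absurd hs h2⟩
    · exact fun u w _ hcw hu hw huw =>
        h.modulator.not_adj_of_detached hu (hG hcw) hw (hG huw)
  -- Far from `X` the neighbourhood of the centre is the same as in `G`.
  intro ho
  have hd : ∀ {p}, (G.deleteEdges (neededEdges G X A T S : Set (Sym2 V))).Adj c p →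
      Detached G X c p := by
    intro p hp
    have hp' := hG hp
    exact ⟨hp', hcX, fun hpX => hx ⟨p, hpX, hp'.symm⟩, fun y hy hh => hx ⟨y, hy, hh.1⟩⟩
  have hadj : ∀ {p q}, (G.deleteEdges (neededEdges G X A T S : Set (Sym2 V))).Adj c p →
      (G.deleteEdges (neededEdges G X A T S : Set (Sym2 V))).Adj c q →
      ((G.deleteEdges (neededEdges G X A T S : Set (Sym2 V))).Adj p q ↔ G.Adj p q) := by
    intro p q hp hq
    refine ⟨hG, fun hpq => ?_⟩
    rw [hdet (h.modulator.detached_of_triangle (hd hp).symm hpq (hG hq))]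
    exact ⟨((hdet (hd hp)).1 hp).2, ((hdet (hd hq)).1 hq).2⟩
  obtain ⟨h1, h2, h3, h4⟩ := ho
  rw [hadj h1 h3, hadj h1 h2, hadj h2 h3] at h4
  have := h.modulator c u v w ⟨hG h1, hG h2, hG h3, h4⟩
  have := (hd h1).2.2.1
  have := (hd h2).2.2.1
  unfold HasEdgeIn at *
  tauto

end Solution

/-- The reduced graph is equivalent to the original one. -/
theorem deletable_iff [Finite V] [LinearOrder V] (h : IsKeptSet G X A T) {k : ℕ}
    (hT : 2 * k + 6 ≤ T) : Deletable (reduced G X A T) k ↔ Deletable G k := by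
  constructor
  · classical
    rintro ⟨S, hsub, hk, hS⟩
    exact deletable_of_finset (neededEdges G X A T S)
      ((Finset.card_filter_le _ _).trans hk)
      (h.not_obstruction hk hT hsub hS)
  · exact Deletable.of_locally_induced (Function.Embedding.refl V) (fun _ _ h => h.1)
      fun v u w hu hw huw => reduced_locally_induced h.modulator hu hw huw

end IsKeptSet

end Restore

/-! ### The kept vertices and the size of the reduced graph -/

section Counting

variable {V : Type*}

theorem ncard_biUnion_le {α : Type*} [Finite α] (s : Set α) (f : α → Set V) {m : ℕ}
    (h : ∀ x ∈ s, (f x).ncard ≤ m) : (⋃ x ∈ s, f x).ncard ≤ s.ncard * m := by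
  classical
  induction s, Set.toFinite s using Set.Finite.induction_on with
  | empty => simp
  | @insert a s ha hs ih =>
    rw [Set.biUnion_insert, Set.ncard_insert_of_notMem ha]
    have h1 := Set.ncard_union_le (f a) (⋃ x ∈ s, f x)
    have h2 := h a (Set.mem_insert _ _)
    have h3 := ih fun x hx => h x (Set.mem_insert_of_mem _ hx)
    rw [Nat.add_mul]
    omega

variable [Finite V] {G : SimpleGraph V} {X : Set V}

/-- Few vertices see the difference between two vertices of the modulator: adjacent ones would have
the witness `q` in their common clique. -/
theorem ncard_separating_le (hX : IsModulator G X) (x : V) {y : V} (hy : y ∈ X) :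
    {a | a ∉ X ∧ G.Adj x a ∧ G.Adj y a ∧
      ∃ q, q ∉ X ∧ G.Adj q a ∧ G.Adj x q ∧ ¬ G.Adj y q}.ncard ≤ 2 := by
  by_contra! hlt
  obtain ⟨a, b, c, ha, hb, hc, hab, hac, hbc⟩ := (Set.two_lt_ncard_iff (Set.toFinite _)).1 hlt
  have hn : ∀ {a b}, (a ∉ X ∧ G.Adj x a ∧ G.Adj y a ∧
      ∃ q, q ∉ X ∧ G.Adj q a ∧ G.Adj x q ∧ ¬ G.Adj y q) → (b ∉ X ∧ G.Adj x b ∧ G.Adj y b ∧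
      ∃ q, q ∉ X ∧ G.Adj q b ∧ G.Adj x q ∧ ¬ G.Adj y q) → ¬ G.Adj a b := by
    rintro a b ⟨ha, hxa, hya, q, hq, hqa, hxq, hyq⟩ ⟨hb, hxb, hyb, -⟩ hab
    have hqb : q ≠ b := by rintro rfl; exact hyq hyb
    have hqb' : G.Adj q b := hX.adj_of_common' ha hq hb hxa hxq hxb hqa.symm hab hqb
    have hqy : q ≠ y := by rintro rfl; exact hq hy
    exact hyq (hX.adj_of_common ha hb hab hya.symm hqa.symm hyb.symm hqb'.symm hqy.symm)
  exact hn ha hc (hX.adj_of_three' ha.1 hb.1 hc.1 ha.2.1 hb.2.1 hc.2.1 hab hbc hac (hn ha hb)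
    (hn hb hc))

variable [LinearOrder V]

theorem ncard_le_of_low {D : Set V} {T : ℕ} (h : ∀ d ∈ D, {w | w ∈ D ∧ w < d}.ncard < T) :
    D.ncard ≤ T := by
  rcases D.eq_empty_or_nonempty with rfl | hne
  · simp
  obtain ⟨m, hm, hmax⟩ := D.toFinite.exists_maximal hne
  have hsub : D ⊆ insert m {w | w ∈ D ∧ w < m} := by
    intro w hw
    rcases lt_or_ge w m with hlt | hge
    · exact Or.inr ⟨hw, hlt⟩
    · exact Or.inl (le_antisymm (hmax hw hge) hge)
  have h1 := Set.ncard_le_ncard hsub (Set.toFinite _)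
  have h2 := Set.ncard_insert_le m {w | w ∈ D ∧ w < m}
  have h3 := h m hm
  omega

theorem le_ncard_low {D : Set V} {T : ℕ} (h : T ≤ D.ncard) :
    T ≤ {d | d ∈ D ∧ {w | w ∈ D ∧ w < d}.ncard < T}.ncard := by
  by_contra! hlt
  set L := {d | d ∈ D ∧ {w | w ∈ D ∧ w < d}.ncard < T} with hL
  obtain ⟨m, ⟨hm, hmL⟩, hmin⟩ := (Set.toFinite (D \ L)).exists_minimal
    (Set.nonempty_of_ncard_ne_zero (by
      have := Set.le_ncard_sdiff L D
      omega))
  apply hmL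
  refine ⟨hm, (Set.ncard_le_ncard ?_ (Set.toFinite _)).trans_lt hlt⟩
  rintro w ⟨hw, hwm⟩
  by_contra hwL
  exact absurd (hmin ⟨hw, hwL⟩ hwm.le) (not_le.2 hwm)

/-- The kept vertices outside the modulator: in each clique attached to a vertex of `X` the `T`
smallest vertices, and all the vertices in which two attached cliques meet. -/
def keptSet (G : SimpleGraph V) (X : Set V) (T : ℕ) : Set V :=
  {a | a ∉ X ∧ ((∃ x ∈ X, G.Adj x a ∧ {w | w ∉ X ∧ w < a ∧ G.Adj w x ∧ G.Adj w a}.ncard < T) ∨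
    ∃ q, q ∉ X ∧ G.Adj q a ∧ (∃ x ∈ X, G.Adj x a ∧ G.Adj x q) ∧
      ∃ x ∈ X, G.Adj x a ∧ ¬ G.Adj x q)}

theorem isKeptSet_keptSet (hX : IsModulator G X) (T : ℕ) : IsKeptSet G X (keptSet G X T) T where
  modulator := hX
  notMem a ha := ha.1
  exists_adj := by
    rintro a ⟨-, ⟨x, hx, hxa, -⟩ | ⟨q, -, -, ⟨x, hx, hxa, -⟩, -⟩⟩ <;> exact ⟨x, hx, hxa⟩
  many := by
    intro a ha haA x hx hxa
    have hD : T ≤ {w | w ∉ X ∧ w < a ∧ G.Adj w x ∧ G.Adj w a}.ncard := by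
      by_contra hlt
      exact haA ⟨ha, Or.inl ⟨x, hx, hxa, not_le.1 hlt⟩⟩
    refine (le_ncard_low hD).trans (Set.ncard_le_ncard ?_ (Set.toFinite _))
    rintro d ⟨⟨hdX, hda, hdx, hda'⟩, hd⟩
    refine ⟨⟨hdX, Or.inl ⟨x, hx, hdx.symm, ?_⟩⟩, hda', hdx⟩
    refine (Set.ncard_le_ncard ?_ (Set.toFinite _)).trans_lt hd
    rintro w ⟨hwX, hwd, hwx, hwd'⟩
    exact ⟨⟨hwX, hwd.trans hda, hwx, hX.adj_of_common' hdX hwX ha hdx.symm hwx.symm hxa hwd'.symm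
      hda' (hwd.trans hda).ne⟩, hwd⟩
  single := by
    intro a ha haA x hx x' hx' q hq hxa hxa' hqa hqx
    by_contra hn
    exact haA ⟨ha, Or.inr ⟨q, hq, hqa, ⟨x, hx, hxa, hqx.symm⟩, x', hx', hxa', fun h => hn h.symm⟩⟩

theorem ncard_low_neighbors_le (hX : IsModulator G X) (x : V) (T : ℕ) :
    {a | a ∉ X ∧ G.Adj x a ∧ {w | w ∉ X ∧ w < a ∧ G.Adj w x ∧ G.Adj w a}.ncard < T}.ncard ≤
      2 * T := by
  set N := {a | a ∉ X ∧ G.Adj x a ∧ {w | w ∉ X ∧ w < a ∧ G.Adj w x ∧ G.Adj w a}.ncard < T} with hN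
  have clique : ∀ D ⊆ N, (∀ a ∈ D, ∀ b ∈ D, a ≠ b → G.Adj a b) → D.ncard ≤ T := by
    intro D hD hadj
    refine ncard_le_of_low fun d hd => lt_of_le_of_lt ?_ (hD hd).2.2
    refine Set.ncard_le_ncard ?_ (Set.toFinite _)
    rintro w ⟨hw, hwd⟩
    exact ⟨(hD hw).1, hwd, (hD hw).2.1.symm, hadj w hw d hd hwd.ne⟩
  rcases N.eq_empty_or_nonempty with h | ⟨a, ha⟩
  · simp [h]
  have h1 := clique {b | b ∈ N ∧ (b = a ∨ G.Adj b a)} (fun b hb => hb.1) (by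
    rintro b ⟨hb, hba⟩ c ⟨hc, hca⟩ hbc
    rcases hba with rfl | hba
    · exact (hca.resolve_left hbc.symm).symm
    · rcases hca with rfl | hca
      · exact hba
      · exact hX.adj_of_common' ha.1 hb.1 hc.1 ha.2.1 hb.2.1 hc.2.1 hba.symm hca.symm hbc)
  have h2 := clique {b | b ∈ N ∧ ¬ (b = a ∨ G.Adj b a)} (fun b hb => hb.1) (by
    rintro b ⟨hb, hba⟩ c ⟨hc, hca⟩ hbc
    push Not at hba hca
    exact hX.adj_of_three' hb.1 ha.1 hc.1 hb.2.1 ha.2.1 hc.2.1 hba.1 hca.1.symm hbc hba.2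
      fun h => hca.2 h.symm)
  have hsub : N ⊆ {b | b ∈ N ∧ (b = a ∨ G.Adj b a)} ∪ {b | b ∈ N ∧ ¬ (b = a ∨ G.Adj b a)} := by
    intro b hb
    by_cases h : b = a ∨ G.Adj b a
    · exact Or.inl ⟨hb, h⟩
    · exact Or.inr ⟨hb, h⟩
  have h3 := Set.ncard_le_ncard hsub (Set.toFinite _)
  have h4 := Set.ncard_union_le {b | b ∈ N ∧ (b = a ∨ G.Adj b a)}
    {b | b ∈ N ∧ ¬ (b = a ∨ G.Adj b a)}
  omega

theorem ncard_keptSet_le (hX : IsModulator G X) (T : ℕ) :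
    (keptSet G X T).ncard ≤ X.ncard * (2 * T) + X.ncard * (X.ncard * 2) := by
  have hsub : keptSet G X T ⊆
      (⋃ x ∈ X, {a | a ∉ X ∧ G.Adj x a ∧ {w | w ∉ X ∧ w < a ∧ G.Adj w x ∧ G.Adj w a}.ncard < T}) ∪
      ⋃ x ∈ X, ⋃ y ∈ X, {a | a ∉ X ∧ G.Adj x a ∧ G.Adj y a ∧
        ∃ q, q ∉ X ∧ G.Adj q a ∧ G.Adj x q ∧ ¬ G.Adj y q} := by
    rintro a ⟨ha, ⟨x, hx, hxa, hlt⟩ | ⟨q, hq, hqa, ⟨x, hx, hxa, hxq⟩, y, hy, hya, hyq⟩⟩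
    · exact Or.inl (Set.mem_biUnion hx ⟨ha, hxa, hlt⟩)
    · exact Or.inr (Set.mem_biUnion hx (Set.mem_biUnion hy ⟨ha, hxa, hya, q, hq, hqa, hxq, hyq⟩))
  refine (Set.ncard_le_ncard hsub (Set.toFinite _)).trans ((Set.ncard_union_le _ _).trans ?_)
  refine Nat.add_le_add ?_ ?_
  · exact ncard_biUnion_le X _ fun x _ => ncard_low_neighbors_le hX x T
  · exact ncard_biUnion_le X _ fun x _ => ncard_biUnion_le X _ fun y hy =>
      ncard_separating_le hX x hy

/-- The `T` smallest vertices of the detached clique of `a`, other than `a`. -/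
def lowDetached (G : SimpleGraph V) (X : Set V) (T : ℕ) (a : V) : Set V :=
  {u | Detached G X a u ∧ lowCount G X a u < T}

theorem ncard_lowDetached_le (hX : IsModulator G X) {x a : V} (hx : x ∈ X) (hxa : G.Adj x a)
    (T : ℕ) : (lowDetached G X T a).ncard ≤ T := by
  refine ncard_le_of_low fun d hd => lt_of_le_of_lt ?_ hd.2
  refine Set.ncard_le_ncard ?_ (Set.toFinite _)
  rintro w ⟨hw, hwd⟩
  exact ⟨hw.1.2.2.1, hwd, hX.adj_of_detached hx hxa hw.1 hd.1 hwd.ne, Or.inr hw.1.1.symm⟩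

variable {A : Set V} {T : ℕ}

theorem ncard_support_reduced_le (h : IsKeptSet G X A T) :
    {u | ∃ v, (reduced G X A T).Adj u v}.ncard ≤ X.ncard + A.ncard + A.ncard * T := by
  have hsub : {u | ∃ v, (reduced G X A T).Adj u v} ⊆ X ∪ A ∪ ⋃ a ∈ A, lowDetached G X T a := by
    rintro u ⟨v, -, ⟨hu, -⟩ | ⟨a, ha, rfl | ⟨hu, h | h⟩, -⟩⟩
    · exact Or.inl hu
    · exact Or.inl (Or.inr ha)
    · exact Or.inl (Or.inr h)
    · exact Or.inr (Set.mem_biUnion ha ⟨hu, h⟩)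
  refine (Set.ncard_le_ncard hsub (Set.toFinite _)).trans ((Set.ncard_union_le _ _).trans ?_)
  refine Nat.add_le_add (Set.ncard_union_le _ _) (ncard_biUnion_le A _ fun a ha => ?_)
  obtain ⟨x, hx, hxa⟩ := h.exists_adj a ha
  exact ncard_lowDetached_le h.modulator hx hxa T

theorem ncard_edgeSet_reduced_le (h : IsKeptSet G X A T) :
    (reduced G X A T).edgeSet.ncard ≤
      (X.ncard + A.ncard) * (X.ncard + A.ncard) + A.ncard * ((T + 1) * (T + 1)) := by
  have hsub : (reduced G X A T).edgeSet ⊆ (fun p : V × V => s(p.1, p.2)) ''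
      ((X ∪ A) ×ˢ (X ∪ A) ∪
        ⋃ a ∈ A, (insert a (lowDetached G X T a)) ×ˢ (insert a (lowDetached G X T a))) := by
    intro e he
    induction e using Sym2.ind with
    | _ u v =>
      refine ⟨(u, v), ?_, rfl⟩
      change (reduced G X A T).Adj u v at he
      obtain ⟨huv, hh | ⟨a, ha, hu, hv⟩⟩ := he
      · exact Or.inl hh
      by_cases huA : u ∈ A
      · by_cases hvA : v ∈ A
        · exact Or.inl ⟨Or.inr huA, Or.inr hvA⟩
        have hd := detached_of_stays h.modulator huv hu hv
        rcases stays_of_stays h.modulator hu (Or.inl rfl) hv huv (Or.inr hd) ha with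
          rfl | ⟨-, h' | h'⟩
        · exact absurd huA hvA
        · exact absurd h' hvA
        · exact Or.inr (Set.mem_biUnion huA ⟨Or.inl rfl, Or.inr ⟨hd, h'⟩⟩)
      · rcases hu with rfl | ⟨hu, h' | hul⟩
        · exact absurd ha huA
        · exact absurd h' huA
        by_cases hvA : v ∈ A
        · have hu' : Stays G X A T a u := Or.inr ⟨hu, Or.inr hul⟩
          have hd := detached_of_stays h.modulator huv hu' hv
          rcases stays_of_stays h.modulator hv (Or.inl rfl) hu' huv.symm (Or.inr hd.symm) ha with
            rfl | ⟨-, h' | h'⟩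
          · exact absurd hvA huA
          · exact absurd h' huA
          · exact Or.inr (Set.mem_biUnion hvA ⟨Or.inr ⟨hd.symm, h'⟩, Or.inl rfl⟩)
        · rcases hv with rfl | ⟨hv, h' | hvl⟩
          · exact absurd ha hvA
          · exact absurd h' hvA
          · exact Or.inr (Set.mem_biUnion ha ⟨Or.inr ⟨hu, hul⟩, Or.inr ⟨hv, hvl⟩⟩)
  refine (Set.ncard_le_ncard hsub (Set.toFinite _)).trans
    ((Set.ncard_image_le (Set.toFinite _)).trans ((Set.ncard_union_le _ _).trans ?_))
  refine Nat.add_le_add ?_ (ncard_biUnion_le A _ fun a ha => ?_)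
  · rw [Set.ncard_prod]
    exact Nat.mul_le_mul (Set.ncard_union_le _ _) (Set.ncard_union_le _ _)
  · obtain ⟨x, hx, hxa⟩ := h.exists_adj a ha
    have h1 := ncard_lowDetached_le h.modulator hx hxa T
    have h2 := Set.ncard_insert_le a (lowDetached G X T a)
    rw [Set.ncard_prod]
    exact Nat.mul_le_mul (by omega) (by omega)

/-- The reduced graph of a greedy packing of obstructions that stops after `k + 1` obstructions. If
the packing is not complete then nothing is kept but the packing, which shows that `k` edges do
not suffice. -/
theorem reduced_spec {k m : ℕ} (hk : 0 < k) (hp : Packing G X m) (hm : m ≤ k + 1)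
    (hX : m ≤ k → IsModulator G X) (hA : A = {a | m ≤ k ∧ a ∈ keptSet G X (2 * k + 6)}) :
    (Deletable (reduced G X A (2 * k + 6)) k ↔ Deletable G k) ∧
      {u | ∃ v, (reduced G X A (2 * k + 6)).Adj u v}.ncard ≤ 100000 * k ^ 3 ∧
      (reduced G X A (2 * k + 6)).edgeSet.ncard ≤ 100000 * k ^ 4 := by
  -- As `1 ≤ k`, both `4 * (k + 1)` and `2 * k + 6` are at most `8 * k`.
  have hXk : X.ncard ≤ 8 * k := by
    have := hp.ncard_le
    omega
  by_cases hmk : m ≤ k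
  · have hA' : A = keptSet G X (2 * k + 6) := by simp [hA, hmk]
    have h : IsKeptSet G X A (2 * k + 6) := by
      rw [hA']; exact isKeptSet_keptSet (hX hmk) _
    have hAk : A.ncard ≤ 256 * k ^ 2 := by
      have h1 := ncard_keptSet_le (hX hmk) (2 * k + 6)
      rw [← hA'] at h1
      have h2 : X.ncard * (2 * (2 * k + 6)) ≤ 8 * k * (2 * (8 * k)) :=
        Nat.mul_le_mul hXk (by omega)
      have h3 : X.ncard * (X.ncard * 2) ≤ 8 * k * (8 * k * 2) :=
        Nat.mul_le_mul hXk (Nat.mul_le_mul_right _ hXk)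
      nlinarith
    have hkk : k ≤ k ^ 2 := Nat.le_self_pow (by norm_num) k
    refine ⟨h.deletable_iff le_rfl, (ncard_support_reduced_le h).trans ?_,
      (ncard_edgeSet_reduced_le h).trans ?_⟩
    · have h1 : A.ncard * (2 * k + 6) ≤ 256 * k ^ 2 * (8 * k) := Nat.mul_le_mul hAk (by omega)
      have h2 : k ^ 2 ≤ k ^ 3 := Nat.pow_le_pow_right hk (by norm_num)
      have h3 : 256 * k ^ 2 * (8 * k) = 2048 * k ^ 3 := by ring
      omega
    · have h1 : X.ncard + A.ncard ≤ 264 * k ^ 2 := by omega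
      have h2 : (X.ncard + A.ncard) * (X.ncard + A.ncard) ≤ 264 * k ^ 2 * (264 * k ^ 2) :=
        Nat.mul_le_mul h1 h1
      have h3 : (2 * k + 6 + 1) * (2 * k + 6 + 1) ≤ 9 * k * (9 * k) :=
        Nat.mul_le_mul (by omega) (by omega)
      have h4 : A.ncard * ((2 * k + 6 + 1) * (2 * k + 6 + 1)) ≤ 256 * k ^ 2 * (9 * k * (9 * k)) :=
        Nat.mul_le_mul hAk h3
      have h5 : 264 * k ^ 2 * (264 * k ^ 2) = 69696 * k ^ 4 := by ring
      have h6 : 256 * k ^ 2 * (9 * k * (9 * k)) = 20736 * k ^ 4 := by ring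
      omega
  · have hA' : A = ∅ := by simp [hA, hmk]
    subst hA'
    have hred : ∀ u v, (reduced G X ∅ (2 * k + 6)).Adj u v ↔ G.Adj u v ∧ u ∈ X ∧ v ∈ X := by
      intro u v
      simp [reduced_adj]
    refine ⟨⟨fun h => absurd h ?_, fun h => absurd h ?_⟩, ?_, ?_⟩
    · exact hp.not_deletable (fun u hu v hv => by simp [hred, hu, hv]) (by omega)
    · exact hp.not_deletable (fun u hu v hv => Iff.rfl) (by omega)
    · have h1 : {u | ∃ v, (reduced G X ∅ (2 * k + 6)).Adj u v}.ncard ≤ X.ncard :=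
        Set.ncard_le_ncard (fun u ⟨v, h⟩ => ((hred u v).1 h).2.1) (Set.toFinite _)
      have h2 : k ≤ k ^ 3 := Nat.le_self_pow (by norm_num) k
      omega
    · have h1 : (reduced G X ∅ (2 * k + 6)).edgeSet ⊆
          (fun p : V × V => s(p.1, p.2)) '' (X ×ˢ X) := by
        intro e he
        induction e using Sym2.ind with
        | _ u v => exact ⟨(u, v), ((hred u v).1 he).2, rfl⟩
      have h2 := (Set.ncard_le_ncard h1 (Set.toFinite _)).trans
        (Set.ncard_image_le (Set.toFinite _))
      rw [Set.ncard_prod] at h2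
      have h3 : X.ncard * X.ncard ≤ 8 * k * (8 * k) := Nat.mul_le_mul hXk hXk
      have h4 : 8 * k * (8 * k) = 64 * k ^ 2 := by ring
      have h5 : k ^ 2 ≤ k ^ 4 := Nat.pow_le_pow_right hk (by norm_num)
      omega

end Counting

/-! ### Verified programs: bounded loops and tables -/

namespace RAM

/-- Started in `s`, the program `P` halts after at most `B` steps in a memory that satisfies `Q`. -/
def Reaches (P : Program) (s : State) (B : ℕ) (Q : State → Prop) : Prop :=
  ∃ s' t, Exec P s s' t ∧ t ≤ B ∧ Q s'

theorem Reaches.mono {P : Program} {s : State} {B B' : ℕ} {Q Q' : State → Prop}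
    (h : Reaches P s B Q) (hB : B ≤ B') (hQ : ∀ s', Q s' → Q' s') : Reaches P s B' Q' := by
  obtain ⟨s', t, h1, h2, h3⟩ := h
  exact ⟨s', t, h1, h2.trans hB, hQ _ h3⟩

theorem Reaches.seq {P P' : Program} {s : State} {B B' : ℕ} {Q Q' : State → Prop}
    (h : Reaches P s B Q) (h' : ∀ s', Q s' → Reaches P' s' B' Q') :
    Reaches (.seq P P') s (B + B') Q' := by
  obtain ⟨s', t, h1, h2, h3⟩ := h
  obtain ⟨s'', t', h1', h2', h3'⟩ := h' s' h3
  exact ⟨s'', t + t', .seq h1 h1', Nat.add_le_add h2 h2', h3'⟩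

theorem reaches_assign {x : ℕ} {e : Expr} {s : State} {Q : State → Prop}
    (h : Q (s.setVar x (e.eval s))) : Reaches (.assign x e) s (e.cost + 1) Q :=
  ⟨_, _, .assign s x e, le_rfl, h⟩

theorem reaches_store {a : ℕ} {i j e : Expr} {s : State} {Q : State → Prop}
    (h : Q (s.setArr a (i.eval s) (j.eval s) (e.eval s))) :
    Reaches (.store a i j e) s (i.cost + j.cost + e.cost + 1) Q :=
  ⟨_, _, .store s a i j e, le_rfl, h⟩

theorem reaches_cond {e : Expr} {P P' : Program} {s : State} {B : ℕ} {Q : State → Prop}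
    (h : e.eval s ≠ 0 → Reaches P s B Q) (h' : e.eval s = 0 → Reaches P' s B Q) :
    Reaches (.cond e P P') s (e.cost + 1 + B) Q := by
  by_cases he : e.eval s = 0
  · obtain ⟨s', t, h1, h2, h3⟩ := h' he
    exact ⟨s', _, .cond_false he h1, Nat.add_le_add_left h2 _, h3⟩
  · obtain ⟨s', t, h1, h2, h3⟩ := h he
    exact ⟨s', _, .cond_true he h1, Nat.add_le_add_left h2 _, h3⟩

@[simp] theorem State.setVar_var (s : State) (x v y : ℕ) :
    (s.setVar x v).var y = if y = x then v else s.var y := rfl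

@[simp] theorem State.setVar_arr (s : State) (x v : ℕ) : (s.setVar x v).arr = s.arr := rfl

@[simp] theorem State.setArr_var (s : State) (a i j v : ℕ) : (s.setArr a i j v).var = s.var := rfl

@[simp] theorem State.setArr_arr (s : State) (a i j v b p q : ℕ) :
    (s.setArr a i j v).arr b p q = if b = a ∧ p = i ∧ q = j then v else s.arr b p q := rfl

/-- Execute `P` for the values `0, …, n - 1` of the variable `x`, where `n` is the value of the
variable `0`. -/
def forLoop (x : ℕ) (P : Program) : Program :=
  .seq (.assign x (.const 0))
    (.loop (.sub (.var 0) (.var x)) (.seq P (.assign x (.add (.var x) (.const 1)))))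

/-- The number of steps of a loop with `n` rounds of `B` steps. -/
def loopBound (n B : ℕ) : ℕ := n * (B + 8) + 6

/-- The invariant rule for bounded loops. -/
theorem forLoop_reaches {x : ℕ} (hx : x ≠ 0) {P : Program} {n B : ℕ} {Inv : ℕ → State → Prop}
    {s : State} (hn : s.var 0 = n) (h0 : Inv 0 (s.setVar x 0))
    (hstep : ∀ i < n, ∀ s : State, s.var 0 = n → s.var x = i → Inv i s → Reaches P s B fun s' =>
      s'.var 0 = n ∧ s'.var x = i ∧ Inv (i + 1) (s'.setVar x (i + 1))) :
    Reaches (forLoop x P) s (loopBound n B) fun s' => s'.var 0 = n ∧ Inv n s' := by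
  have key : ∀ r i, i + r = n → ∀ s : State, s.var 0 = n → s.var x = i → Inv i s →
      Reaches (.loop (.sub (.var 0) (.var x)) (.seq P (.assign x (.add (.var x) (.const 1))))) s
        (r * (B + 8) + 4) fun s' => s'.var 0 = n ∧ Inv n s' := by
    intro r
    induction r with
    | zero =>
      intro i hi s hs hsx hI
      refine ⟨s, _, .loop_false ?_, ?_, hs, ?_⟩
      · simp [Expr.eval, hs, hsx]; omega
      · simp [Expr.cost]
      · rwa [← hi]
    | succ r ih =>
      intro i hi s hs hsx hI
      obtain ⟨s', t, h1, h2, h3, h4, h5⟩ := hstep i (by omega) s hs hsx hI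
      have ev : (Expr.add (.var x) (.const 1)).eval s' = i + 1 := by simp [Expr.eval, h4]
      obtain ⟨s'', t', g1, g2, g3⟩ := ih (i + 1) (by omega) (s'.setVar x (i + 1))
        (by simp [hx.symm, h3]) (by simp) h5
      have hne : (Expr.sub (.var 0) (.var x)).eval s ≠ 0 := by
        simp only [Expr.eval, hs, hsx]; omega
      have ha := Exec.assign s' x (.add (.var x) (.const 1))
      rw [ev] at ha
      refine ⟨s'', _, .loop_true hne (.seq h1 ha) g1, ?_, g3⟩
      simp only [Expr.cost]
      rw [Nat.add_mul]
      omega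
  refine (Reaches.seq (reaches_assign (Q := fun s' => s' = s.setVar x 0) rfl) ?_).mono
    (B := 2 + (n * (B + 8) + 4)) (by unfold loopBound; omega) (fun _ h => h)
  rintro s' rfl
  exact key n 0 (by omega) _ (by simp [hx.symm, hn]) (by simp) h0

/-- Add up the values of `e` for the values `0, …, n - 1` of the variable `12` in the variable
`13`. -/
def sumLoop (e : Expr) : Program :=
  .seq (.assign 13 (.const 0)) (forLoop 12 (.assign 13 (.add (.var 13) e)))

/-- The number of steps of the addition of `n` values of the expression `e`. -/
def sumBound (e : Expr) (n : ℕ) : ℕ := 2 + loopBound n (e.cost + 3)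

theorem sumLoop_reaches {e : Expr} {n : ℕ} {s : State} (hn : s.var 0 = n) (val : ℕ → ℕ)
    (he : ∀ w < n, ∀ s₁ : State, s₁.arr = s.arr → (∀ x, x ≠ 12 → x ≠ 13 → s₁.var x = s.var x) →
      s₁.var 12 = w → e.eval s₁ = val w) :
    Reaches (sumLoop e) s (sumBound e n) fun s' =>
      s'.var 13 = ∑ w ∈ Finset.range n, val w ∧ s'.arr = s.arr ∧
        ∀ x, x ≠ 12 → x ≠ 13 → s'.var x = s.var x := by
  refine Reaches.seq (reaches_assign (Q := fun s' => s' = s.setVar 13 0) rfl) ?_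
  rintro _ rfl
  refine (forLoop_reaches (by norm_num) (n := n) (by simpa using hn)
    (Inv := fun i s' => s'.var 13 = ∑ w ∈ Finset.range i, val w ∧ s'.arr = s.arr ∧
        ∀ x, x ≠ 12 → x ≠ 13 → s'.var x = s.var x) ?_ ?_).mono le_rfl fun s' h => h.2
  · refine ⟨by simp, by simp, ?_⟩
    intro x h1 h2
    simp [h1, h2]
  · rintro i hi s₁ hs0 hsx ⟨h1, h2, h3⟩
    refine (reaches_assign ?_).mono (by simp [Expr.cost]; omega) fun _ h => h
    refine ⟨by simpa using hs0, by simpa using hsx, ?_, by simpa using h2, ?_⟩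
    · simp [Expr.eval, Finset.sum_range_succ, h1, he i hi s₁ h2 h3 hsx]
    · intro x hx hx'
      simp [hx, hx', h3 x hx hx']

/-- The two memories agree except for the array `c` and the variables from `10` on, which serve as
loop variables and accumulators. -/
def Agree (c : ℕ) (s s' : State) : Prop :=
  (∀ x < 10, s'.var x = s.var x) ∧ ∀ b, b ≠ c → s'.arr b = s.arr b

/-- Fill the array `c` for all `i, j < n`, held in the variables `10` and `11`: add up the values
of `e` for all values `w < n` of the variable `12` in the variable `13`, then evaluate `g`. -/
def tabulate (c : ℕ) (e g : Expr) : Program :=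
  forLoop 10 (forLoop 11 (.seq (sumLoop e) (.store c (.var 10) (.var 11) g)))

/-- The number of steps of the computation of a table. -/
def tabulateBound (e g : Expr) (n : ℕ) : ℕ :=
  loopBound n (loopBound n (sumBound e n + (1 + 1 + g.cost + 1)))

theorem tabulate_reaches {c : ℕ} {e g : Expr} {n : ℕ} {s : State} (hn : s.var 0 = n)
    (val : ℕ → ℕ → ℕ → ℕ) (out : ℕ → ℕ → ℕ)
    (he : ∀ i < n, ∀ j < n, ∀ w < n, ∀ s₁ : State, Agree c s s₁ → s₁.var 10 = i → s₁.var 11 = j →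
      s₁.var 12 = w → e.eval s₁ = val i j w)
    (hg : ∀ i < n, ∀ j < n, ∀ s₁ : State, Agree c s s₁ → s₁.var 10 = i → s₁.var 11 = j →
      s₁.var 13 = ∑ w ∈ Finset.range n, val i j w → g.eval s₁ = out i j) :
    Reaches (tabulate c e g) s (tabulateBound e g n) fun s' =>
      Agree c s s' ∧ ∀ i < n, ∀ j < n, s'.arr c i j = out i j := by
  have agree_set : ∀ {s' : State} {x v : ℕ}, 10 ≤ x → Agree c s s' → Agree c s (s'.setVar x v) := by
    intro s' x v hx h
    refine ⟨fun y hy => ?_, fun b hb => by simpa using h.2 b hb⟩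
    have : y ≠ x := by omega
    simpa [this] using h.1 y hy
  refine (forLoop_reaches (by norm_num) hn (Inv := fun i s' => Agree c s s' ∧
    ∀ p < i, ∀ q < n, s'.arr c p q = out p q) ⟨agree_set le_rfl ⟨fun _ _ => rfl, fun _ _ => rfl⟩,
      by simp⟩ ?_).mono le_rfl fun s' h => h.2
  rintro i hi s₁ hs0 hsi ⟨ha, hp⟩
  refine (forLoop_reaches (by norm_num) hs0 (Inv := fun j s' => s'.var 10 = i ∧ Agree c s s' ∧
    (∀ p < i, ∀ q < n, s'.arr c p q = out p q) ∧ ∀ q < j, s'.arr c i q = out i q)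
    ⟨by simpa using hsi, agree_set (by norm_num) ha, by simpa using hp, by simp⟩ ?_).mono le_rfl ?_
  · rintro j hj s₂ hs0 hsj ⟨hsi, ha, hp, hq⟩
    refine Reaches.seq (sumLoop_reaches hs0 (val i j) ?_) ?_
    · intro w hw s₃ h1 h2 h3
      refine he i hi j hj w hw s₃ ⟨fun x hx => ?_, fun b hb => ?_⟩ ?_ ?_ h3
      · rw [h2 x (by omega) (by omega), ha.1 x hx]
      · rw [h1, ha.2 b hb]
      · rw [h2 _ (by norm_num) (by norm_num), hsi]
      · rw [h2 _ (by norm_num) (by norm_num), hsj]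
    · rintro s₃ ⟨h1, h2, h3⟩
      have hi3 : s₃.var 10 = i := by rw [h3 _ (by norm_num) (by norm_num), hsi]
      have hj3 : s₃.var 11 = j := by rw [h3 _ (by norm_num) (by norm_num), hsj]
      have h03 : s₃.var 0 = n := by rw [h3 _ (by norm_num) (by norm_num), hs0]
      have ha3 : Agree c s s₃ := by
        refine ⟨fun x hx => ?_, fun b hb => ?_⟩
        · rw [h3 x (by omega) (by omega), ha.1 x hx]
        · rw [h2, ha.2 b hb]
      have hv := hg i hi j hj s₃ ha3 hi3 hj3 h1
      refine reaches_store ?_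
      simp only [Expr.eval, hi3, hj3, hv]
      refine ⟨h03, hj3, by simpa using hi3, agree_set (by norm_num) ⟨ha3.1, fun b hb => ?_⟩, ?_, ?_⟩
      · funext p q
        simp [hb, ha3.2 b hb]
      · intro p hpi q hq'
        have : p ≠ i := hpi.ne
        simp [this, h2, hp p hpi q hq']
      · intro q hqj
        by_cases hqj' : q = j
        · simp [hqj']
        · simp [hqj', h2, hq q (by omega)]
  · rintro s' ⟨h0, h10, ha, hp, hq⟩
    refine ⟨h0, h10, agree_set le_rfl ha, ?_⟩
    intro p hpi q hqn
    rcases Nat.lt_succ_iff_lt_or_eq.1 hpi with h | rfl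
    · simpa using hp p h q hqn
    · simpa using hq q hqn

/-! ### Verified programs: relations as tables -/

open Classical in
/-- The expression `e` computes the truth value of `p`. -/
def Decides (e : Expr) (s : State) (p : Prop) : Prop := e.eval s = if p then 1 else 0

namespace Expr

/-- Negation of a truth value. -/
def not (e : Expr) : Expr := .sub (.const 1) e

/-- Conjunction of truth values. -/
def and (e e' : Expr) : Expr := .sub (.add e e') (.const 1)

/-- Disjunction of truth values. -/
def or (e e' : Expr) : Expr := not (and (not e) (not e'))

/-- The truth value of `e < e'`. -/
def lt (e e' : Expr) : Expr := not (not (.sub e' e))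

/-- The truth value of `e = e'`. -/
def eq (e e' : Expr) : Expr := not (.add (.sub e e') (.sub e' e))

/-- The cell of the array `c` whose row and column are given by the variables `x` and `y`. -/
def cell (c x y : ℕ) : Expr := .get c (.var x) (.var y)

end Expr

namespace Decides

variable {e e' : Expr} {s : State} {p q : Prop}

theorem congr (h : Decides e s p) (hpq : p ↔ q) : Decides e s q := by
  rwa [← propext hpq]

theorem eval_ne_zero (h : Decides e s p) : e.eval s ≠ 0 ↔ p := by
  unfold Decides at h
  by_cases p <;> simp_all

theorem not (h : Decides e s p) : Decides e.not s (¬ p) := by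
  unfold Decides at *
  by_cases p <;> simp_all [Expr.not, Expr.eval]

theorem and (h : Decides e s p) (h' : Decides e' s q) : Decides (e.and e') s (p ∧ q) := by
  unfold Decides at *
  by_cases p <;> by_cases q <;> simp_all [Expr.and, Expr.eval]

theorem or (h : Decides e s p) (h' : Decides e' s q) : Decides (e.or e') s (p ∨ q) :=
  (h.not.and h'.not).not.congr (by tauto)

theorem lt (e e' : Expr) (s : State) : Decides (e.lt e') s (e.eval s < e'.eval s) := by
  unfold Decides
  simp only [Expr.lt, Expr.not, Expr.eval]
  split <;> omega

theorem eq (e e' : Expr) (s : State) : Decides (e.eq e') s (e.eval s = e'.eval s) := by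
  unfold Decides
  simp only [Expr.eq, Expr.not, Expr.eval]
  split <;> omega

end Decides

open Classical in
/-- The array `c` holds the relation `R` on `0, …, n - 1`. -/
def Holds {n : ℕ} (s : State) (c : ℕ) (R : Fin n → Fin n → Prop) : Prop :=
  ∀ i j : Fin n, s.arr c i j = if R i j then 1 else 0

theorem Holds.decides {n : ℕ} {s : State} {c : ℕ} {R : Fin n → Fin n → Prop} (h : Holds s c R)
    {x y : ℕ} {i j : Fin n} (hx : s.var x = i) (hy : s.var y = j) :
    Decides (.cell c x y) s (R i j) := by
  simp [Decides, Expr.cell, Expr.eval, hx, hy, h i j]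

theorem Holds.of_agree {n : ℕ} {s s' : State} {b c : ℕ} {R : Fin n → Fin n → Prop}
    (h : Holds s b R) (hs : Agree c s s') (hb : b ≠ c) : Holds s' b R := by
  intro i j
  rw [hs.2 b hb]
  exact h i j

theorem sum_decides {n : ℕ} (φ : Fin n → Prop) [DecidablePred φ] :
    (∑ w ∈ Finset.range n, if h : w < n then (if φ ⟨w, h⟩ then 1 else 0) else 0) =
      {w | φ w}.ncard := by
  rw [Finset.sum_range]
  simp only [Fin.is_lt, dite_true, Fin.eta]
  rw [Finset.sum_boole, Set.ncard_eq_toFinset_card', Set.toFinset_ofPred]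
  simp

theorem tabulate_holds {c : ℕ} {e g : Expr} {n : ℕ} {s : State} (hn : s.var 0 = n)
    (φ : Fin n → Fin n → Fin n → Prop) (ψ : Fin n → Fin n → Prop)
    (he : ∀ i j w : Fin n, ∀ s₁ : State, Agree c s s₁ → s₁.var 10 = i → s₁.var 11 = j →
      s₁.var 12 = w → Decides e s₁ (φ i j w))
    (hg : ∀ i j : Fin n, ∀ s₁ : State, Agree c s s₁ → s₁.var 10 = i → s₁.var 11 = j →
      s₁.var 13 = {w | φ i j w}.ncard → Decides g s₁ (ψ i j)) :
    Reaches (tabulate c e g) s (tabulateBound e g n) fun s' => Agree c s s' ∧ Holds s' c ψ := by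
  classical
  refine (tabulate_reaches hn
    (fun i j w => if hi : i < n then if hj : j < n then if hw : w < n then
      (if φ ⟨i, hi⟩ ⟨j, hj⟩ ⟨w, hw⟩ then 1 else 0) else 0 else 0 else 0)
    (fun i j => if hi : i < n then if hj : j < n then
      (if ψ ⟨i, hi⟩ ⟨j, hj⟩ then 1 else 0) else 0 else 0) ?_ ?_).mono le_rfl ?_
  · intro i hi j hj w hw s₁ ha h10 h11 h12
    simpa [hi, hj, hw, Decides] using he ⟨i, hi⟩ ⟨j, hj⟩ ⟨w, hw⟩ s₁ ha h10 h11 h12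
  · intro i hi j hj s₁ ha h10 h11 h13
    have := hg ⟨i, hi⟩ ⟨j, hj⟩ s₁ ha h10 h11
    rw [← sum_decides] at this
    simpa [hi, hj, Decides] using this (by simpa [hi, hj] using h13)
  · rintro s' ⟨ha, h⟩
    refine ⟨ha, fun i j => ?_⟩
    simpa using h i i.2 j j.2

end RAM

/-! ### The program for the greedy packing -/

namespace RAM

/-- The test whether the values of the variables `20`, …, `23` form an obstruction. -/
def obstructionTest : Expr :=
  (Expr.cell 0 20 21).and ((Expr.cell 0 20 22).and ((Expr.cell 0 20 23).and
    ((Expr.eq (.var 21) (.var 23)).not.and ((Expr.cell 0 21 23).not.and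
      (((Expr.cell 0 21 22).and (Expr.cell 0 22 23)).or
        ((Expr.eq (.var 21) (.var 22)).not.and ((Expr.eq (.var 22) (.var 23)).not.and
          ((Expr.cell 0 21 22).not.and (Expr.cell 0 22 23).not))))))))

/-- The test whether an obstruction has an edge inside the set in the diagonal of the array `1`. -/
def edgeTest : Expr :=
  ((Expr.cell 1 20 20).and ((Expr.cell 1 21 21).or ((Expr.cell 1 22 22).or (Expr.cell 1 23 23)))).or
    (((Expr.cell 0 21 22).and ((Expr.cell 1 21 21).and (Expr.cell 1 22 22))).or
      ((Expr.cell 0 22 23).and ((Expr.cell 1 22 22).and (Expr.cell 1 23 23))))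

/-- Add the value of the variable `x` to the set in the diagonal of the array `1`. -/
def mark (x : ℕ) : Program := .store 1 (.var x) (.var x) (.const 1)

/-- The test that decides if a quadruple is added to the packing. -/
def packTest : Expr :=
  (Expr.lt (.var 1) (.var 2)).not.and (obstructionTest.and edgeTest.not)

/-- Add a quadruple to the packing, if possible, and count it in the variable `2`. -/
def packStep : Program :=
  .cond packTest
    (.seq (mark 20) (.seq (mark 21) (.seq (mark 22) (.seq (mark 23)
      (.assign 2 (.add (.var 2) (.const 1))))))) .skip

/-- Go through all the quadruples of vertices and form a packing, but stop when it has more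
members than the parameter. -/
def packProgram : Program :=
  forLoop 20 (forLoop 21 (forLoop 22 (forLoop 23 packStep)))

/-- The number of steps of the greedy packing; the addition of a quadruple takes at most `20`
steps. -/
def packBound (n : ℕ) : ℕ :=
  loopBound n (loopBound n (loopBound n (loopBound n (packTest.cost + 1 + 20))))

/-- The memory holds a packing for the graph `G`. If the packing has at most `k` members, then each
obstruction among the quadruples that are `done` has an edge inside it. -/
def PackInv {n : ℕ} (G : SimpleGraph (Fin n)) (k : ℕ)
    (done : Fin n → Fin n → Fin n → Fin n → Prop) (s : State) : Prop :=
  ∃ (X : Set (Fin n)) (m : ℕ), s.var 1 = k ∧ s.var 2 = m ∧ Holds s 0 G.Adj ∧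
    Holds (n := n) s 1 (fun i j => i = j ∧ i ∈ X) ∧ Packing G X m ∧ m ≤ k + 1 ∧
    (m ≤ k → ∀ c u v w, done c u v w → Obstruction G c u v w → HasEdgeIn G X c u v w)

variable {n k : ℕ} {G : SimpleGraph (Fin n)} {done done' : Fin n → Fin n → Fin n → Fin n → Prop}

theorem PackInv.mono {s : State} (h : PackInv G k done s)
    (hd : ∀ c u v w, done' c u v w → done c u v w) : PackInv G k done' s := by
  obtain ⟨X, m, h1, h2, h3, h4, h5, h6, h7⟩ := h
  exact ⟨X, m, h1, h2, h3, h4, h5, h6, fun hm c u v w hh => h7 hm c u v w (hd c u v w hh)⟩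

theorem PackInv.setVar {s : State} (h : PackInv G k done s) {x v : ℕ} (hx : 2 < x) :
    PackInv G k done (s.setVar x v) := by
  obtain ⟨X, m, h1, h2, h3⟩ := h
  have e1 : (1 : ℕ) ≠ x := by omega
  have e2 : (2 : ℕ) ≠ x := by omega
  exact ⟨X, m, by simpa [e1] using h1, by simpa [e2] using h2, h3⟩

theorem packStep_reaches {s : State} {c u v w : Fin n} (hc : s.var 20 = c) (hu : s.var 21 = u)
    (hv : s.var 22 = v) (hw : s.var 23 = w) (hI : PackInv G k done s) :
    Reaches packStep s (packTest.cost + 1 + 20) fun s' =>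
      (∀ x, x ≠ 2 → s'.var x = s.var x) ∧ PackInv G k (fun c' u' v' w' => done c' u' v' w' ∨
        c' = c ∧ u' = u ∧ v' = v ∧ w' = w) s' := by
  obtain ⟨X, m, h1, h2, h3, h4, h5, h6, h7⟩ := hI
  have hX : ∀ {x : ℕ} {a : Fin n}, s.var x = a → Decides (.cell 1 x x) s (a ∈ X) := fun hx =>
    (h4.decides hx hx).congr (by simp)
  have hne : ∀ {x y : ℕ} {a b : Fin n}, s.var x = a → s.var y = b →
      Decides (Expr.eq (.var x) (.var y)).not s (a ≠ b) := fun {x y a b} hx hy =>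
    (Decides.eq (.var x) (.var y) s).not.congr (by simp [Expr.eval, hx, hy, Fin.ext_iff])
  have hobs : Decides obstructionTest s (Obstruction G c u v w) := by
    have h := (h3.decides hc hu).and ((h3.decides hc hv).and ((h3.decides hc hw).and
      ((hne hu hw).and ((h3.decides hu hw).not.and
        (((h3.decides hu hv).and (h3.decides hv hw)).or ((hne hu hv).and ((hne hv hw).and
          ((h3.decides hu hv).not.and (h3.decides hv hw).not))))))))
    exact h
  have hedge : Decides edgeTest s (HasEdgeIn G X c u v w) :=
    ((hX hc).and ((hX hu).or ((hX hv).or (hX hw)))).or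
      (((h3.decides hu hv).and ((hX hu).and (hX hv))).or
        ((h3.decides hv hw).and ((hX hv).and (hX hw))))
  have htest : Decides packTest s (m ≤ k ∧ Obstruction G c u v w ∧ ¬ HasEdgeIn G X c u v w) :=
    ((Decides.lt (.var 1) (.var 2) s).not.congr (by simp [Expr.eval, h1, h2])).and
      (hobs.and hedge.not)
  refine reaches_cond (fun ht => ?_) (fun ht => ?_)
  · obtain ⟨hmk, ho, he⟩ := htest.eval_ne_zero.1 ht
    refine ⟨_, _, .seq (.store _ _ _ _ _) (.seq (.store _ _ _ _ _) (.seq (.store _ _ _ _ _)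
      (.seq (.store _ _ _ _ _) (.assign _ _ _)))), by simp [Expr.cost], ?_, ?_⟩
    · intro x hx
      simp [hx]
    · refine ⟨X ∪ {c, u, v, w}, m + 1, ?_, ?_, ?_, ?_, h5.extend ho he, by omega, ?_⟩
      · simpa using h1
      · simp [Expr.eval, h2]
      · intro i j
        simp [Expr.eval, h3 i j]
      · intro i j
        have hmem : i ∈ X ∪ {c, u, v, w} ↔ i ∈ X ∨ i = c ∨ i = u ∨ i = v ∨ i = w := by
          simp only [Set.mem_union, Set.mem_insert_iff, Set.mem_singleton_iff]
        simp only [State.setVar_arr, State.setArr_arr, Expr.eval, State.setArr_var, hc, hu, hv, hw,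
          h4 i j, true_and, Fin.val_inj, hmem]
        by_cases hij : i = j
        · subst hij
          clear hX hne hobs hedge htest ht ho he h5 h7 h4 h3
          by_cases i ∈ X <;> by_cases i = c <;> by_cases i = u <;> by_cases i = v <;>
            by_cases i = w <;> simp [*]
        · have hno : ∀ a : Fin n, ¬ (i = a ∧ j = a) := fun a h => hij (h.1.trans h.2.symm)
          simp [hij, hno]
      · intro hmk' c' u' v' w' hd ho'
        rcases hd with hd | ⟨rfl, rfl, rfl, rfl⟩
        · exact (h7 hmk c' u' v' w' hd ho').mono Set.subset_union_left
        · left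
          simp
  · refine ⟨s, 1, .skip s, by norm_num, fun _ _ => rfl, X, m, h1, h2, h3, h4, h5, h6, ?_⟩
    intro hmk c' u' v' w' hd ho
    rcases hd with hd | ⟨rfl, rfl, rfl, rfl⟩
    · exact h7 hmk c' u' v' w' hd ho
    · by_contra he
      exact htest.eval_ne_zero.2 ⟨hmk, ho, he⟩ ht

theorem packProgram_reaches {s : State} (hn : s.var 0 = n)
    (hI : PackInv G k (fun _ _ _ _ => False) s) :
    Reaches packProgram s (packBound n) fun s' =>
      s'.var 0 = n ∧ PackInv G k (fun _ _ _ _ => True) s' := by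
  refine (forLoop_reaches (by norm_num) hn (Inv := fun a s' =>
    PackInv G k (fun c _ _ _ => (c : ℕ) < a) s') ?_ ?_).mono le_rfl ?_
  · exact (hI.mono (by simp)).setVar (by norm_num)
  · intro a ha s₁ hs0 hsa hI
    refine (forLoop_reaches (by norm_num) hs0 (Inv := fun b s' => s'.var 20 = a ∧
      PackInv G k (fun c u _ _ => (c : ℕ) < a ∨ (c : ℕ) = a ∧ (u : ℕ) < b) s') ?_ ?_).mono le_rfl ?_
    · exact ⟨by simpa using hsa, (hI.mono (by simp)).setVar (by norm_num)⟩
    · rintro b hb s₂ hs0 hsb ⟨hsa, hI⟩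
      refine (forLoop_reaches (by norm_num) hs0 (Inv := fun d s' => s'.var 20 = a ∧ s'.var 21 = b ∧
        PackInv G k (fun c u v _ => ((c : ℕ) < a ∨ (c : ℕ) = a ∧ (u : ℕ) < b) ∨
          (c : ℕ) = a ∧ (u : ℕ) = b ∧ (v : ℕ) < d) s') ?_ ?_).mono le_rfl ?_
      · exact ⟨by simpa using hsa, by simpa using hsb, (hI.mono (by simp)).setVar (by norm_num)⟩
      · rintro d hd s₃ hs0 hsd ⟨hsa, hsb, hI⟩
        refine (forLoop_reaches (by norm_num) hs0 (Inv := fun f s' => s'.var 20 = a ∧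
          s'.var 21 = b ∧ s'.var 22 = d ∧
          PackInv G k (fun c u v w => (((c : ℕ) < a ∨ (c : ℕ) = a ∧ (u : ℕ) < b) ∨
            (c : ℕ) = a ∧ (u : ℕ) = b ∧ (v : ℕ) < d) ∨
            (c : ℕ) = a ∧ (u : ℕ) = b ∧ (v : ℕ) = d ∧ (w : ℕ) < f) s') ?_ ?_).mono le_rfl ?_
        · exact ⟨by simpa using hsa, by simpa using hsb, by simpa using hsd,
            (hI.mono (by simp)).setVar (by norm_num)⟩
        · rintro f hf s₄ hs0 hsf ⟨hsa, hsb, hsd, hI⟩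
          refine (packStep_reaches (c := ⟨a, ha⟩) (u := ⟨b, hb⟩) (v := ⟨d, hd⟩) (w := ⟨f, hf⟩)
            hsa hsb hsd hsf hI).mono le_rfl ?_
          rintro s' ⟨hs', hI'⟩
          refine ⟨by rw [hs' _ (by norm_num), hs0], by rw [hs' _ (by norm_num), hsf], ?_, ?_, ?_,
            (hI'.mono ?_).setVar (by norm_num)⟩
          · simpa [hs'] using hsa
          · simpa [hs'] using hsb
          · simpa [hs'] using hsd
          · intro c u v w h
            simp only [Fin.ext_iff]
            omega
        · rintro s' ⟨h0, h1, h2, h3, hI⟩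
          refine ⟨h0, h3, by simpa using h1, by simpa using h2, (hI.mono ?_).setVar (by norm_num)⟩
          intro c u v w h
          have := w.2
          omega
      · rintro s' ⟨h0, h1, h2, hI⟩
        refine ⟨h0, h2, by simpa using h1, (hI.mono ?_).setVar (by norm_num)⟩
        intro c u v w h
        have := v.2
        omega
    · rintro s' ⟨h0, h1, hI⟩
      refine ⟨h0, h1, (hI.mono ?_).setVar (by norm_num)⟩
      intro c u v w h
      have := u.2
      omega
  · rintro s' ⟨h0, hI⟩
    exact ⟨h0, hI.mono fun c u v w _ => c.2⟩

end RAM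

/-! ### The program for the reduced graph -/

namespace RAM

section Tables

variable {n : ℕ}

/-- The set `A` of kept vertices that belongs to a packing with `m` members and vertex set `X`. -/
def packingKept (G : SimpleGraph (Fin n)) (X : Set (Fin n)) (k m : ℕ) : Set (Fin n) :=
  {a | m ≤ k ∧ a ∈ keptSet G X (2 * k + 6)}

/-- The reduced graph of a packing with `m` members and vertex set `X`. -/
def packingReduced (G : SimpleGraph (Fin n)) (X : Set (Fin n)) (k m : ℕ) :
    SimpleGraph (Fin n) :=
  reduced G X (packingKept G X k m) (2 * k + 6)

/-- The relations held by the arrays during the computation of the reduced graph. The array `9`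
numbers the vertices of the reduced graph that are not isolated. -/
def tableRel (G : SimpleGraph (Fin n)) (X : Set (Fin n)) (k m : ℕ) : ℕ → Fin n → Fin n → Prop
  | 0 => G.Adj
  | 1 => fun i j => i = j ∧ i ∈ X
  | 2 => fun i j => ∃ x ∈ X, G.Adj x i ∧ G.Adj x j
  | 3 => fun i j => j ∈ X ∧ G.Adj j i ∧
      {w | w ∉ X ∧ w < i ∧ G.Adj w j ∧ G.Adj w i}.ncard < 2 * k + 6
  | 4 => fun i j => j ∉ X ∧ G.Adj j i ∧ (∃ x ∈ X, G.Adj x i ∧ G.Adj x j) ∧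
      ∃ x ∈ X, G.Adj x i ∧ ¬ G.Adj x j
  | 5 => fun i _ => i ∈ packingKept G X k m
  | 6 => fun i j => i ∈ packingKept G X k m ∧
      Stays G X (packingKept G X k m) (2 * k + 6) i j
  | 7 => (packingReduced G X k m).Adj
  | 8 => fun i _ => ∃ v, (packingReduced G X k m).Adj i v
  | 9 => fun i j => (∃ v, (packingReduced G X k m).Adj j v) ∧
      {w | (∃ v, (packingReduced G X k m).Adj w v) ∧ w < j}.ncard = i
  | 10 => fun i j => ∃ w, ((∃ v, (packingReduced G X k m).Adj w v) ∧
      {w' | (∃ v, (packingReduced G X k m).Adj w' v) ∧ w' < w}.ncard = i) ∧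
      (packingReduced G X k m).Adj w j
  | _ => fun _ _ => False

/-- The first `c` tables are computed. -/
def TablesInv (G : SimpleGraph (Fin n)) (X : Set (Fin n)) (k m c : ℕ) (s : State) : Prop :=
  s.var 0 = n ∧ s.var 1 = k ∧ s.var 2 = m ∧ ∀ b < c, Holds s b (tableRel G X k m b)

variable {G : SimpleGraph (Fin n)} {X : Set (Fin n)} {k m c : ℕ} {s : State}

theorem TablesInv.of_agree {b : ℕ} (h : TablesInv G X k m c s) {s' : State} (hs : Agree b s s')
    (hb : c ≤ b) : TablesInv G X k m c s' := by
  obtain ⟨h0, h1, h2, h3⟩ := h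
  refine ⟨by rw [hs.1 _ (by norm_num), h0], by rw [hs.1 _ (by norm_num), h1],
    by rw [hs.1 _ (by norm_num), h2], fun d hd => (h3 d hd).of_agree hs (by omega)⟩

theorem TablesInv.cell (h : TablesInv G X k m c s) (b : ℕ) (hb : b < c) {x y : ℕ} {i j : Fin n}
    (hx : s.var x = i) (hy : s.var y = j) : Decides (.cell b x y) s (tableRel G X k m b i j) :=
  (h.2.2.2 b hb).decides hx hy

theorem TablesInv.mem (h : TablesInv G X k m c s) (hc : 1 < c) {x : ℕ} {i : Fin n}
    (hx : s.var x = i) : Decides (.cell 1 x x) s (i ∈ X) :=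
  (h.cell 1 hc hx hx).congr (by simp [tableRel])

theorem decides_var_lt {x y : ℕ} {i j : Fin n} (hx : s.var x = i) (hy : s.var y = j) :
    Decides (.lt (.var x) (.var y)) s (i < j) :=
  (Decides.lt _ _ s).congr (by simp [Expr.eval, hx, hy])

theorem decides_var_eq {x y : ℕ} {i j : Fin n} (hx : s.var x = i) (hy : s.var y = j) :
    Decides (.eq (.var x) (.var y)) s (i = j) :=
  (Decides.eq _ _ s).congr (by simp [Expr.eval, hx, hy, Fin.ext_iff])

/-- The test whether the accumulator is positive. -/
def positiveTest : Expr := .lt (.const 0) (.var 13)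

theorem decides_positiveTest {φ : Fin n → Prop} (h : s.var 13 = {w | φ w}.ncard) :
    Decides positiveTest s (∃ w, φ w) :=
  (Decides.lt _ _ s).congr (by
    simp only [Expr.eval, h]
    rw [Set.ncard_pos (Set.toFinite _)]
    rfl)

/-- The test whether the accumulator is less than `2 * k + 6`. -/
def thresholdTest : Expr := .lt (.var 13) (.add (.add (.var 1) (.var 1)) (.const 6))

theorem TablesInv.threshold (h : TablesInv G X k m c s) {φ : Fin n → Prop}
    (h13 : s.var 13 = {w | φ w}.ncard) :
    Decides thresholdTest s ({w | φ w}.ncard < 2 * k + 6) :=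
  (Decides.lt _ _ s).congr (by simp only [Expr.eval, h13, h.2.1]; omega)

theorem tabulate_tables {e g : Expr} (hs : TablesInv G X k m c s)
    (φ : Fin n → Fin n → Fin n → Prop)
    (he : ∀ i j w : Fin n, ∀ s₁ : State, TablesInv G X k m c s₁ → s₁.var 10 = i → s₁.var 11 = j →
      s₁.var 12 = w → Decides e s₁ (φ i j w))
    (hg : ∀ i j : Fin n, ∀ s₁ : State, TablesInv G X k m c s₁ → s₁.var 10 = i → s₁.var 11 = j →
      s₁.var 13 = {w | φ i j w}.ncard → Decides g s₁ (tableRel G X k m c i j)) :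
    Reaches (tabulate c e g) s (tabulateBound e g n) (TablesInv G X k m (c + 1)) := by
  refine (tabulate_holds hs.1 φ (tableRel G X k m c)
    (fun i j w s₁ ha => he i j w s₁ (hs.of_agree ha le_rfl))
    (fun i j s₁ ha => hg i j s₁ (hs.of_agree ha le_rfl))).mono le_rfl ?_
  rintro s' ⟨ha, h⟩
  obtain ⟨h0, h1, h2, h3⟩ := hs.of_agree ha le_rfl
  refine ⟨h0, h1, h2, fun b hb => ?_⟩
  rcases Nat.lt_succ_iff_lt_or_eq.1 hb with hb | rfl
  · exact h3 b hb
  · exact h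

/-- The summand for the table of pairs with a common neighbour in the modulator. -/
def commonSum : Expr := (Expr.cell 1 12 12).and ((Expr.cell 0 12 10).and (Expr.cell 0 12 11))

/-- The summand for the position of a vertex in a clique attached to the modulator. -/
def lowSum : Expr :=
  (Expr.cell 1 12 12).not.and ((Expr.lt (.var 12) (.var 10)).and
    ((Expr.cell 0 12 11).and (Expr.cell 0 12 10)))

/-- The entry for the smallest vertices of the attached cliques. -/
def lowEntry : Expr := (Expr.cell 1 11 11).and ((Expr.cell 0 11 10).and thresholdTest)

/-- The summand for the vertices in which attached cliques meet. -/
def meetSum : Expr := (Expr.cell 1 12 12).and ((Expr.cell 0 12 10).and (Expr.cell 0 12 11).not)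

/-- The entry for the vertices in which attached cliques meet. -/
def meetEntry : Expr :=
  (Expr.cell 1 11 11).not.and ((Expr.cell 0 11 10).and ((Expr.cell 2 10 11).and positiveTest))

/-- The summand for the kept vertices. -/
def keptSum : Expr := (Expr.cell 3 10 12).or (Expr.cell 4 10 12)

/-- The entry for the kept vertices. -/
def keptEntry : Expr :=
  (Expr.lt (.var 1) (.var 2)).not.and ((Expr.cell 1 10 10).not.and positiveTest)

/-- The summand for the position of a vertex in a detached clique. -/
def staysSum : Expr :=
  (Expr.cell 1 12 12).not.and ((Expr.lt (.var 12) (.var 11)).and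
    ((Expr.cell 0 12 11).and ((Expr.eq (.var 12) (.var 10)).or (Expr.cell 0 12 10))))

/-- The entry for the vertices that stay in a detached clique. -/
def staysEntry : Expr :=
  (Expr.cell 5 10 10).and ((Expr.eq (.var 11) (.var 10)).or
    (((Expr.cell 0 10 11).and ((Expr.cell 1 10 10).not.and ((Expr.cell 1 11 11).not.and
      (Expr.cell 2 10 11).not))).and ((Expr.cell 5 11 11).or thresholdTest)))

/-- The summand for the edges in the detached cliques. -/
def reducedSum : Expr := (Expr.cell 6 12 10).and (Expr.cell 6 12 11)

/-- The entry for the edges of the reduced graph. -/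
def reducedEntry : Expr :=
  (Expr.cell 0 10 11).and ((((Expr.cell 1 10 10).or (Expr.cell 5 10 10)).and
    ((Expr.cell 1 11 11).or (Expr.cell 5 11 11))).or positiveTest)

/-- The summand for the number of a vertex in the reduced instance. -/
def rankSum : Expr := (Expr.cell 8 12 12).and (Expr.lt (.var 12) (.var 11))

/-- The entry for the number of a vertex in the reduced instance. -/
def rankEntry : Expr := (Expr.cell 8 11 11).and (Expr.eq (.var 13) (.var 10))

/-- The summand for the adjacencies of a vertex of the reduced instance. -/
def rowSum : Expr := (Expr.cell 9 10 12).and (Expr.cell 7 12 11)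

/-- The summand for the edges of the reduced instance. -/
def outputSum : Expr := (Expr.cell 9 11 12).and (Expr.cell 10 10 12)

/-- Compute the tables, and write the reduced instance over the given one. -/
def tablesProgram : Program :=
  .seq (tabulate 2 commonSum positiveTest) (.seq (tabulate 3 lowSum lowEntry)
    (.seq (tabulate 4 meetSum meetEntry) (.seq (tabulate 5 keptSum keptEntry)
      (.seq (tabulate 6 staysSum staysEntry) (.seq (tabulate 7 reducedSum reducedEntry)
        (.seq (tabulate 8 (.cell 7 10 12) positiveTest) (.seq (tabulate 9 rankSum rankEntry)
          (.seq (tabulate 10 rowSum positiveTest) (.seq (tabulate 0 outputSum positiveTest)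
            (.seq (sumLoop (.cell 8 12 12)) (.assign 0 (.var 13))))))))))))

/-- The number of steps of the computation of the reduced instance. -/
def tablesBound (n : ℕ) : ℕ :=
  tabulateBound commonSum positiveTest n + (tabulateBound lowSum lowEntry n +
    (tabulateBound meetSum meetEntry n + (tabulateBound keptSum keptEntry n +
      (tabulateBound staysSum staysEntry n + (tabulateBound reducedSum reducedEntry n +
        (tabulateBound (.cell 7 10 12) positiveTest n + (tabulateBound rankSum rankEntry n +
          (tabulateBound rowSum positiveTest n + (tabulateBound outputSum positiveTest n +
            (sumBound (.cell 8 12 12) n + 2))))))))))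

theorem tablesProgram_reaches (hs : TablesInv G X k m 2 s) :
    Reaches tablesProgram s (tablesBound n) fun s' =>
      s'.var 0 = {u | ∃ v, (packingReduced G X k m).Adj u v}.ncard ∧ s'.var 1 = k ∧
      Holds s' 0 fun i j : Fin n => ∃ w, tableRel G X k m 9 j w ∧ tableRel G X k m 10 i w := by
  refine Reaches.seq (tabulate_tables hs (fun i j w => w ∈ X ∧ G.Adj w i ∧ G.Adj w j)
    (fun i j w s₁ h hi hj hw => (h.mem (by norm_num) hw).and
      ((h.cell 0 (by norm_num) hw hi).and (h.cell 0 (by norm_num) hw hj)))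
    (fun i j s₁ h hi hj h13 => decides_positiveTest h13)) ?_
  intro s hs
  refine Reaches.seq (tabulate_tables hs
    (fun i j w => w ∉ X ∧ w < i ∧ G.Adj w j ∧ G.Adj w i)
    (fun i j w s₁ h hi hj hw => (h.mem (by norm_num) hw).not.and ((decides_var_lt hw hi).and
      ((h.cell 0 (by norm_num) hw hj).and (h.cell 0 (by norm_num) hw hi))))
    (fun i j s₁ h hi hj h13 => (h.mem (by norm_num) hj).and ((h.cell 0 (by norm_num) hj hi).and
      (h.threshold h13)))) ?_
  intro s hs
  refine Reaches.seq (tabulate_tables hs (fun i j w => w ∈ X ∧ G.Adj w i ∧ ¬ G.Adj w j)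
    (fun i j w s₁ h hi hj hw => (h.mem (by norm_num) hw).and
      ((h.cell 0 (by norm_num) hw hi).and (h.cell 0 (by norm_num) hw hj).not))
    (fun i j s₁ h hi hj h13 => (h.mem (by norm_num) hj).not.and
      ((h.cell 0 (by norm_num) hj hi).and ((h.cell 2 (by norm_num) hi hj).and
        (decides_positiveTest h13))))) ?_
  intro s hs
  refine Reaches.seq (tabulate_tables hs
    (fun i _ w => tableRel G X k m 3 i w ∨ tableRel G X k m 4 i w)
    (fun i j w s₁ h hi hj hw => (h.cell 3 (by norm_num) hi hw).or (h.cell 4 (by norm_num) hi hw))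
    (fun i j s₁ h hi hj h13 => ((Decides.lt _ _ _).not.and ((h.mem (by norm_num) hi).not.and
        (decides_positiveTest h13))).congr ?_)) ?_
  · simp only [Expr.eval, h.2.1, h.2.2.1, not_lt, tableRel, packingKept, keptSet,
      Set.mem_ofPred_eq, exists_or]
  intro s hs
  refine Reaches.seq (tabulate_tables hs
    (fun i j w => w ∉ X ∧ w < j ∧ G.Adj w j ∧ (w = i ∨ G.Adj w i))
    (fun i j w s₁ h hi hj hw => (h.mem (by norm_num) hw).not.and ((decides_var_lt hw hj).and
      ((h.cell 0 (by norm_num) hw hj).and ((decides_var_eq hw hi).or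
        (h.cell 0 (by norm_num) hw hi)))))
    (fun i j s₁ h hi hj h13 => ((h.cell 5 (by norm_num) hi hi).and ((decides_var_eq hj hi).or
      (((h.cell 0 (by norm_num) hi hj).and ((h.mem (by norm_num) hi).not.and
        ((h.mem (by norm_num) hj).not.and (h.cell 2 (by norm_num) hi hj).not))).and
        ((h.cell 5 (by norm_num) hj hj).or (h.threshold h13))))).congr ?_)) ?_
  · simp only [tableRel, Stays, Detached, lowCount, not_exists, not_and]
  intro s hs
  refine Reaches.seq (tabulate_tables hs
    (fun i j w => tableRel G X k m 6 w i ∧ tableRel G X k m 6 w j)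
    (fun i j w s₁ h hi hj hw => (h.cell 6 (by norm_num) hw hi).and (h.cell 6 (by norm_num) hw hj))
    (fun i j s₁ h hi hj h13 => ((h.cell 0 (by norm_num) hi hj).and
      ((((h.mem (by norm_num) hi).or (h.cell 5 (by norm_num) hi hi)).and
        ((h.mem (by norm_num) hj).or (h.cell 5 (by norm_num) hj hj))).or
        (decides_positiveTest h13))).congr ?_)) ?_
  · simp only [tableRel, packingReduced, reduced_adj, Set.mem_union]
    refine and_congr_right fun _ => or_congr_right (exists_congr fun a => ?_)
    tauto
  intro s hs
  refine Reaches.seq (tabulate_tables hs (fun i _ w => (packingReduced G X k m).Adj i w)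
    (fun i j w s₁ h hi hj hw => h.cell 7 (by norm_num) hi hw)
    (fun i j s₁ h hi hj h13 => decides_positiveTest h13)) ?_
  intro s hs
  refine Reaches.seq (tabulate_tables hs
    (fun _ j w => (∃ v, (packingReduced G X k m).Adj w v) ∧ w < j)
    (fun i j w s₁ h hi hj hw => (h.cell 8 (by norm_num) hw hw).and (decides_var_lt hw hj))
    (fun i j s₁ h hi hj h13 => (h.cell 8 (by norm_num) hj hj).and
      ((Decides.eq _ _ _).congr (by simp only [Expr.eval, h13, hi])))) ?_
  intro s hs
  refine Reaches.seq (tabulate_tables hs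
    (fun i j w => tableRel G X k m 9 i w ∧ (packingReduced G X k m).Adj w j)
    (fun i j w s₁ h hi hj hw => (h.cell 9 (by norm_num) hi hw).and (h.cell 7 (by norm_num) hw hj))
    (fun i j s₁ h hi hj h13 => decides_positiveTest h13)) ?_
  intro s hs
  have tail : ∀ {s' : State}, Agree 0 s s' → s'.var 1 = k ∧ Holds s' 8 (tableRel G X k m 8) ∧
      Holds s' 9 (tableRel G X k m 9) ∧ Holds s' 10 (tableRel G X k m 10) := fun ha =>
    ⟨by rw [ha.1 _ (by norm_num), hs.2.1], (hs.2.2.2 8 (by norm_num)).of_agree ha (by norm_num),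
      (hs.2.2.2 9 (by norm_num)).of_agree ha (by norm_num),
      (hs.2.2.2 10 (by norm_num)).of_agree ha (by norm_num)⟩
  refine Reaches.seq (tabulate_holds hs.1
    (fun i j w => tableRel G X k m 9 j w ∧ tableRel G X k m 10 i w) _
    (fun i j w s₁ ha hi hj hw => ((tail ha).2.2.1.decides hj hw).and
      ((tail ha).2.2.2.decides hi hw))
    (fun i j s₁ ha hi hj h13 => decides_positiveTest h13)) ?_
  rintro s' ⟨ha, hout⟩
  classical
  refine Reaches.seq (sumLoop_reaches (n := n) (by rw [ha.1 _ (by norm_num), hs.1])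
    (fun w => if h : w < n then
      (if ∃ v, (packingReduced G X k m).Adj ⟨w, h⟩ v then 1 else 0) else 0) ?_) ?_
  · intro w hw s₁ h1 h2 h12
    have h8 : Holds s₁ 8 (tableRel G X k m 8) := by
      intro i j
      rw [h1]
      exact (tail ha).2.1 i j
    have := h8.decides (x := 12) (y := 12) (i := ⟨w, hw⟩) (j := ⟨w, hw⟩) h12 h12
    simpa [Decides, hw, tableRel] using this
  · rintro s₁ ⟨h1, h2, h3⟩
    refine reaches_assign ⟨?_, ?_, ?_⟩
    · have h4 := sum_decides fun u => ∃ v, (packingReduced G X k m).Adj u v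
      simp only [State.setVar_var, if_true, Expr.eval]
      rw [h1, ← h4]
    · simpa [h3] using (tail ha).1
    · intro i j
      simpa [h2] using hout i j

end Tables

end RAM

/-! ### The kernelization -/

/-- The vertices of a set `Y`, numbered in increasing order. -/
theorem exists_numbering {n : ℕ} (Y : Set (Fin n)) : ∃ f : Fin Y.ncard ↪ Fin n,
    ∀ (i : Fin Y.ncard) (u : Fin n), (u ∈ Y ∧ {w | w ∈ Y ∧ w < u}.ncard = i) ↔ u = f i := by
  classical
  have hlt : ∀ u : Y, {w | w ∈ Y ∧ w < (u : Fin n)}.ncard < Y.ncard := fun u =>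
    Set.ncard_lt_ncard ⟨fun w hw => hw.1, fun h => lt_irrefl _ (h u.2).2⟩ (Set.toFinite _)
  have hmono : ∀ u v : Y, u < v →
      {w | w ∈ Y ∧ w < (u : Fin n)}.ncard < {w | w ∈ Y ∧ w < (v : Fin n)}.ncard := fun u v huv =>
    Set.ncard_lt_ncard ⟨fun w hw => ⟨hw.1, hw.2.trans huv⟩,
      fun h => lt_irrefl (u : Fin n) (h ⟨u.2, huv⟩).2⟩ (Set.toFinite _)
  have hinj : Function.Injective fun u : Y => (⟨_, hlt u⟩ : Fin Y.ncard) := by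
    intro u v huv
    simp only [Fin.mk.injEq] at huv
    rcases lt_trichotomy u v with h | h | h
    · exact absurd huv (hmono u v h).ne
    · exact h
    · exact absurd huv (hmono v u h).ne'
  have hbij := (Fintype.bijective_iff_injective_and_card _).2
    ⟨hinj, by rw [Fintype.card_fin, ← Nat.card_eq_fintype_card, Nat.card_coe_set_eq]⟩
  let e := Equiv.ofBijective _ hbij
  refine ⟨e.symm.toEmbedding.trans (Function.Embedding.subtype _), fun i u => ?_⟩
  constructor
  · rintro ⟨hu, h⟩
    have : e ⟨u, hu⟩ = i := Fin.ext h
    rw [← this]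
    simp
  · rintro rfl
    refine ⟨(e.symm i).2, ?_⟩
    exact congrArg Fin.val (e.apply_symm_apply i)

namespace RAM

/-- The bound `f` is a polynomial. -/
def IsPolynomial (f : ℕ → ℕ) : Prop := ∃ b : Polynomial ℕ, ∀ n, f n = b.eval n

namespace IsPolynomial

theorem const (c : ℕ) : IsPolynomial fun _ => c := ⟨Polynomial.C c, by simp⟩

theorem add {f g : ℕ → ℕ} (hf : IsPolynomial f) (hg : IsPolynomial g) :
    IsPolynomial fun n => f n + g n := by
  obtain ⟨b, hb⟩ := hf
  obtain ⟨c, hc⟩ := hg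
  exact ⟨b + c, by simp [hb, hc]⟩

theorem loopBound {f : ℕ → ℕ} (hf : IsPolynomial f) :
    IsPolynomial fun n => loopBound n (f n) := by
  obtain ⟨b, hb⟩ := hf
  exact ⟨Polynomial.X * (b + 8) + 6, by simp [RAM.loopBound, hb]⟩

theorem sumBound (e : Expr) : IsPolynomial (sumBound e) :=
  (const 2).add (const _).loopBound

theorem tabulateBound (e g : Expr) : IsPolynomial (tabulateBound e g) :=
  ((sumBound e).add (const _)).loopBound.loopBound

theorem packBound : IsPolynomial packBound :=
  (const _).loopBound.loopBound.loopBound.loopBound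

theorem tablesBound : IsPolynomial tablesBound :=
  (tabulateBound _ _).add ((tabulateBound _ _).add ((tabulateBound _ _).add
    ((tabulateBound _ _).add ((tabulateBound _ _).add ((tabulateBound _ _).add
      ((tabulateBound _ _).add ((tabulateBound _ _).add ((tabulateBound _ _).add
        ((tabulateBound _ _).add ((sumBound _).add (const 2)))))))))))

end IsPolynomial

theorem eval_mono (b : Polynomial ℕ) {m n : ℕ} (h : m ≤ n) : b.eval m ≤ b.eval n := by
  induction b using Polynomial.induction_on' with
  | add p q hp hq => simpa using Nat.add_le_add hp hq
  | monomial d a => simpa using Nat.mul_le_mul_left a (Nat.pow_le_pow_left h d)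

theorem packInv_input (I : GraphInstance) :
    PackInv I.graph I.k (fun _ _ _ _ => False) (State.input I) := by
  refine ⟨∅, 0, by simp [State.input], by simp [State.input], ?_, ?_, .empty, by omega, by simp⟩
  · intro i j
    by_cases h : I.graph.Adj i j <;> simp [State.input, h]
  · intro i j
    simp [State.input]

/-- The whole program computes an equivalent instance of bounded size. -/
theorem exists_reduced_instance (I : GraphInstance) :
    ∃ J : GraphInstance, Reaches (.seq packProgram tablesProgram) (State.input I)
      (packBound I.n + tablesBound I.n) (fun s => s.IsOutput J) ∧
      (I ∈ ClawDiamondFreeEdgeDeletion ↔ J ∈ ClawDiamondFreeEdgeDeletion) ∧ J.k = I.k ∧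
      J.n ≤ 100000 * I.k ^ 3 ∧ J.numEdges ≤ 100000 * I.k ^ 4 := by
  classical
  obtain ⟨s, t, hexec, ht, h0, X, m, h1, h2, h3, h4, hp, hm, hX⟩ :=
    packProgram_reaches (n := I.n) (by simp [State.input]) (packInv_input I)
  have htab : TablesInv I.graph X I.k m 2 s := by
    refine ⟨h0, h1, h2, fun b hb => ?_⟩
    interval_cases b
    · exact h3
    · exact h4
  obtain ⟨s', t', hexec', ht', g0, g1, gout⟩ := tablesProgram_reaches htab
  obtain ⟨hdel, hn, he⟩ := reduced_spec I.k_pos hp hm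
    (fun hmk c u v w ho => hX hmk c u v w trivial ho) (A := packingKept I.graph X I.k m) rfl
  set R := packingReduced I.graph X I.k m with hR
  obtain ⟨f, hf⟩ := exists_numbering {u | ∃ v, R.Adj u v}
  have hrange : ∀ u v, R.Adj u v → u ∈ Set.range f := by
    intro u v huv
    have hlt : {w | w ∈ {u | ∃ v, R.Adj u v} ∧ w < u}.ncard < {u | ∃ v, R.Adj u v}.ncard :=
      Set.ncard_lt_ncard ⟨fun w hw => hw.1, fun h => lt_irrefl _ (h ⟨v, huv⟩).2⟩ (Set.toFinite _)
    exact ⟨⟨_, hlt⟩, ((hf ⟨_, hlt⟩ u).1 ⟨⟨v, huv⟩, rfl⟩).symm⟩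
  refine ⟨⟨{u | ∃ v, R.Adj u v}.ncard, R.comap f, I.k, I.k_pos⟩,
    ⟨s', t + t', .seq hexec hexec', Nat.add_le_add ht ht', g0, g1, ?_⟩, ?_, rfl, hn, ?_⟩
  · intro i j
    have hle : {u | ∃ v, R.Adj u v}.ncard ≤ I.n := by
      simpa using Set.ncard_le_card {u | ∃ v, R.Adj u v}
    have hij := gout ⟨i, i.2.trans_le hle⟩ ⟨j, j.2.trans_le hle⟩
    have e9 : ∀ (i : Fin {u | ∃ v, R.Adj u v}.ncard) (u : Fin I.n),
        tableRel I.graph X I.k m 9 ⟨i, i.2.trans_le hle⟩ u ↔ u = f i := fun i u => hf i u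
    have e10 : ∀ u, tableRel I.graph X I.k m 10 ⟨i, i.2.trans_le hle⟩ u ↔ R.Adj (f i) u := by
      intro u
      change (∃ w, tableRel I.graph X I.k m 9 ⟨i, i.2.trans_le hle⟩ w ∧ R.Adj w u) ↔ _
      simp only [e9, exists_eq_left]
    simp only [e9, e10, exists_eq_left] at hij
    simpa using hij
  · rw [mem_problem_iff, mem_problem_iff]
    change _ ↔ Deletable (R.comap f) I.k
    rw [← hdel]
    exact ⟨Deletable.of_locally_induced f (fun _ _ h => h) (fun _ _ _ _ _ h => h),
      Deletable.of_embedding (SimpleGraph.Embedding.comap f R) hrange⟩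
  · refine le_trans ?_ he
    refine Set.ncard_le_ncard_of_injOn (Sym2.map f) ?_
      (Sym2.map.injective f.injective).injOn (Set.toFinite _)
    intro e he
    induction e using Sym2.ind with
    | _ u v => exact he

end RAM

/-- {Claw, Diamond}-Free Edge Deletion has a kernel with `O(k ^ 3)` vertices and `O(k ^ 4)`
edges. -/
theorem theorem1 :
    ∃ κ : GraphInstance → GraphInstance,
      IsKernelization ClawDiamondFreeEdgeDeletion κ ∧
        ∃ C : ℕ, ∀ I : GraphInstance,
          (κ I).n ≤ C * I.k ^ 3 ∧ (κ I).numEdges ≤ C * I.k ^ 4 := by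
  choose κ hreach hmem hk hn he using RAM.exists_reduced_instance
  refine ⟨κ, ⟨?_, hmem, ⟨id, Computable.id, fun I => (hk I).le⟩,
    ⟨fun k => 100000 * (k * k * k) * (100000 * (k * k * k)), ?_, ?_⟩⟩,
    100000, fun I => ⟨hn I, he I⟩⟩
  · obtain ⟨b, hb⟩ := RAM.IsPolynomial.packBound.add RAM.IsPolynomial.tablesBound
    refine ⟨.seq RAM.packProgram RAM.tablesProgram, b, fun I => ?_⟩
    obtain ⟨s, t, h1, h2, h3⟩ := hreach I
    refine ⟨s, t, h1, h3, h2.trans ?_⟩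
    refine (hb I.n).le.trans ?_
    refine RAM.eval_mono b ?_
    exact (Nat.le_mul_self I.n).trans (Nat.le_add_right _ _)
  · have hcube : Primrec fun k : ℕ => 100000 * (k * k * k) :=
      Primrec.nat_mul.comp (Primrec.const _)
        (Primrec.nat_mul.comp (Primrec.nat_mul.comp Primrec.id Primrec.id) Primrec.id)
    exact (Primrec.nat_mul.comp hcube hcube).to_comp
  · intro I
    have h := hn I
    rw [show I.k ^ 3 = I.k * I.k * I.k by ring] at h
    exact Nat.mul_le_mul h h
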